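/- Let $n\ge 2$ and $p,q\in[1,\infty]$ with $p^{-1}+q^{-1}<1$. There is a constant $C=C(n,p,q)$ with the following property. Let $\Omega\subset\mathbb R^n$ be open and bounded, and let $f=(f_1,\dots,f_n)\in W^{1,n}_{\mathrm{loc}}(\Omega,\mathbb R^n)$ satisfy $$|Df(x)|^n\le K(x)\,\det Df(x)+\Sigma(x)\qquad\text{for a.e. }x\in\Omega,$$ where $Df$ is the weak derivative, $|Df|$ is its operator norm, and $K\colon\Omega\to[1,\infty)$, $\Sigma\colon\Omega\to[0,\infty]$ are measurable functions with $K\in L^p(\Omega)$ and $\Sigma/K\in L^q(\Omega)$. (i) Suppose moreover that $|Df|\in L^n(\Omega)$ (for example, that $f\in W^{1,n}(\Omega,\mathbb R^n)$). Let $i\in\{1,\dots,n\}$, and let $\varphi=(f_i-M)^+$ with $M\in\mathbb R$, or $\varphi=(m-f_i)^+$ with $m\in\mathbb R$. If $\varphi\in W^{1,n}_0(\Omega)$, then $$\|\varphi\|_{L^\infty(\Omega)}^n\le C\,\|K\|_{L^p(\Omega)}\,\Big\|\frac{\Sigma}{K}\Big\|_{L^q(\Omega)}\,[m_n(\Omega)]^{1-p^{-1}-q^{-1}},$$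 where $m_n$ is the Lebesgue measure. (ii) Consequently (without the extra assumption of (i)), every coordinate function $f_i$ is $\alpha$-almost weakly monotone in $\Omega$ with $\alpha=1-p^{-1}-q^{-1}>0$. That is, there is a constant $C'>0$ such that, whenever $B_r$ is an open ball of radius $r>0$ with $\overline{B_r}\subset\Omega$ and $M,m\in\mathbb R$ are such that $(f_i|_{B_r}-M)^+\in W^{1,1}_0(B_r)$ and $(m-f_i|_{B_r})^+\in W^{1,1}_0(B_r)$, we have $\|(f_i|_{B_r}-M)^+\|_{L^\infty(B_r)}\le C'r^\alpha$ and $\|(m-f_i|_{B_r})^+\|_{L^\infty(B_r)}\le C'r^\alpha$. -/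

import Mathlib

open MeasureTheory Set
open scoped ENNReal NNReal ContDiff

/-- Smooth real-valued functions with compact support in `Ω`. -/
def IsTestFunction {n : ℕ} (Ω : Set (EuclideanSpace ℝ (Fin n)))
    (η : EuclideanSpace ℝ (Fin n) → ℝ) : Prop :=
  ContDiff ℝ ∞ η ∧ HasCompactSupport η ∧ tsupport η ⊆ Ω

/-- `Du` is the weak (distributional) total derivative of `u` in the open set `Ω`. Only the values
of `u` and `Du` in `Ω` matter. -/
def HasWeakFDeriv {n : ℕ} {F : Type*} [NormedAddCommGroup F] [NormedSpace ℝ F]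
    (Ω : Set (EuclideanSpace ℝ (Fin n))) (u : EuclideanSpace ℝ (Fin n) → F)
    (Du : EuclideanSpace ℝ (Fin n) → EuclideanSpace ℝ (Fin n) →L[ℝ] F) : Prop :=
  LocallyIntegrableOn u Ω ∧ LocallyIntegrableOn Du Ω ∧
    ∀ η : EuclideanSpace ℝ (Fin n) → ℝ, IsTestFunction Ω η → ∀ v : EuclideanSpace ℝ (Fin n),
      ∫ x in Ω, (fderiv ℝ η x v) • u x = - ∫ x in Ω, η x • Du x v

/-- `u ∈ W^{1,s}_loc(Ω)`, with weak derivative `Du`. -/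
def HasSobolevLocDeriv {n : ℕ} {F : Type*} [NormedAddCommGroup F] [NormedSpace ℝ F]
    (Ω : Set (EuclideanSpace ℝ (Fin n))) (s : ℝ≥0∞) (u : EuclideanSpace ℝ (Fin n) → F)
    (Du : EuclideanSpace ℝ (Fin n) → EuclideanSpace ℝ (Fin n) →L[ℝ] F) : Prop :=
  HasWeakFDeriv Ω u Du ∧
    ∀ S : Set (EuclideanSpace ℝ (Fin n)), IsCompact S → S ⊆ Ω →
      MemLp u s (volume.restrict S) ∧ MemLp Du s (volume.restrict S)

/-- `u ∈ W^{1,s}_loc(Ω)`. -/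
def MemSobolevLoc {n : ℕ} {F : Type*} [NormedAddCommGroup F] [NormedSpace ℝ F]
    (Ω : Set (EuclideanSpace ℝ (Fin n))) (s : ℝ≥0∞)
    (u : EuclideanSpace ℝ (Fin n) → F) : Prop :=
  ∃ Du, HasSobolevLocDeriv Ω s u Du

/-- `u ∈ W^{1,s}_0(Ω)`: the function `u` is in `W^{1,s}(Ω)`, and in the closure of `C^∞_c(Ω)` with
respect to the norm of `W^{1,s}(Ω)`. -/
def MemSobolevZero {n : ℕ} (Ω : Set (EuclideanSpace ℝ (Fin n))) (s : ℝ≥0∞)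
    (u : EuclideanSpace ℝ (Fin n) → ℝ) : Prop :=
  ∃ Du : EuclideanSpace ℝ (Fin n) → EuclideanSpace ℝ (Fin n) →L[ℝ] ℝ,
    HasWeakFDeriv Ω u Du ∧
    MemLp u s (volume.restrict Ω) ∧ MemLp Du s (volume.restrict Ω) ∧
    ∀ ε : ℝ≥0∞, 0 < ε → ∃ η : EuclideanSpace ℝ (Fin n) → ℝ, IsTestFunction Ω η ∧
      eLpNorm (fun x => u x - η x) s (volume.restrict Ω) < ε ∧
      eLpNorm (fun x => Du x - fderiv ℝ η x) s (volume.restrict Ω) < ε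

/-- `u` is `α`-almost weakly monotone in `Ω`. A ball is compactly contained in `Ω` when the
closed ball is a subset of `Ω`. -/
def IsAlmostWeaklyMonotone {n : ℕ} (α : ℝ) (Ω : Set (EuclideanSpace ℝ (Fin n)))
    (u : EuclideanSpace ℝ (Fin n) → ℝ) : Prop :=
  MemSobolevLoc Ω 1 u ∧ 0 < α ∧
    ∃ C : ℝ, 0 < C ∧ ∀ (x₀ : EuclideanSpace ℝ (Fin n)) (r : ℝ), 0 < r →
      Metric.closedBall x₀ r ⊆ Ω → ∀ M m : ℝ,
      MemSobolevZero (Metric.ball x₀ r) 1 (fun x => max (u x - M) 0) →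
      MemSobolevZero (Metric.ball x₀ r) 1 (fun x => max (m - u x) 0) →
      eLpNorm (fun x => max (u x - M) 0) ∞ (volume.restrict (Metric.ball x₀ r))
          ≤ ENNReal.ofReal (C * r ^ α) ∧
      eLpNorm (fun x => max (m - u x) 0) ∞ (volume.restrict (Metric.ball x₀ r))
          ≤ ENNReal.ofReal (C * r ^ α)

/-- The distortion inequality with defect, `|Df|^n ≤ K J_f + Σ` a.e. in `Ω`; here `|Df|` is the
operator norm and `J_f = det Df`. The defect `S` may take the value `∞`. -/
def DistortionInequality {n : ℕ} (Ω : Set (EuclideanSpace ℝ (Fin n)))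
    (Df : EuclideanSpace ℝ (Fin n) → EuclideanSpace ℝ (Fin n) →L[ℝ] EuclideanSpace ℝ (Fin n))
    (K : EuclideanSpace ℝ (Fin n) → ℝ) (S : EuclideanSpace ℝ (Fin n) → ℝ≥0∞) : Prop :=
  ∀ᵐ x ∂(volume.restrict Ω),
    ((‖Df x‖ ^ n : ℝ) : EReal) ≤ ((K x * (Df x).det : ℝ) : EReal) + (S x : EReal)

/-! Write `φ = (σ f_i + b)⁺` with `σ = ±1`, and let `G` be a smooth version of `s ↦ (s - t)⁺` with
`θ = G'(φ) ∈ [0, 1]`. The gradient of `G ∘ φ` is `σ θ Df_i`. The Jacobian is a null Lagrangian: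
replacing row `i` of `Df` by the gradient of a function with zero boundary values makes the integral
of the determinant vanish. With `G ∘ φ` this says `∫ θ det Df = 0`. Dividing the distortion
inequality by `K` and multiplying by `θ` therefore removes the Jacobian and leaves the energy bound
`∫ θ |Df|ⁿ / K ≤ ∫ θ Σ / K` (`lintegral_energy_le`).

Put `A(t) = |{φ > t}|`, `M = ‖K‖_p ‖Σ/K‖_q`, `α = 1 - 1/p - 1/q`. Hölder's inequality turns the
energy bound into `∫ θ |Df| ≤ M^{1/n} A(t)^{1 - (1/p + 1/q)/n}` (`lintegral_mul_le_of_energy_le`).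
The Sobolev inequality from `W^{1,1}` to `L^{n/(n-1)}`, one more Hölder inequality and Chebyshev's
inequality give `(s - t) A(s) ≤ c A(t)^{1 + α/n}` with `c` proportional to `M^{1/n}`
(`level_decay`). Since the exponent exceeds 1, Stampacchia's iteration `eq_zero_of_level_decay`
shows that `A` vanishes beyond a height proportional to `c A(0)^{α/n}`; the `n`-th power of this is
(i).

The delicate point is that `G ∘ φ` may be inserted in the Jacobian, which `IsAdmissibleTruncation`
isolates. In (i), test functions approximate it in `W^{1,n}`. In (ii) only `W^{1,1}_0` of a ball is
assumed, but the gradient `σ θ Df_i` lies in `Lⁿ` anyway; the extension by zero is weakly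
differentiable, and its mollifications are test functions on a slightly larger set, still inside
`Ω`, with gradients converging in `Lⁿ` (`isAdmissibleTruncation_ball`). The power `r^α` is then the
`n`-th root of `|B_r|^α`. -/

section Sobolev

open Filter Topology Metric ContinuousLinearMap

variable {n : ℕ} {F : Type*} [NormedAddCommGroup F] [NormedSpace ℝ F]

local notation "𝔼" => EuclideanSpace ℝ (Fin n)

/-! ### Mollification -/

/-- Convolution with a normalised bump function. -/
noncomputable def mollify (ρ : ContDiffBump (0 : 𝔼)) (g : 𝔼 → F) : 𝔼 → F :=
  convolution (ρ.normed volume) g (lsmul ℝ ℝ) volume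

lemma mollify_congr (ρ : ContDiffBump (0 : 𝔼)) {g h : 𝔼 → F} (hgh : g =ᵐ[volume] h) :
    mollify ρ g = mollify ρ h :=
  convolution_congr _ (ae_eq_refl _) hgh

lemma mollify_apply (ρ : ContDiffBump (0 : 𝔼)) (g : 𝔼 → F) (x : 𝔼) :
    mollify ρ g x = ∫ t, ρ.normed volume t • g (x - t) := rfl

lemma mollify_apply' (ρ : ContDiffBump (0 : 𝔼)) (g : 𝔼 → F) (x : 𝔼) :
    mollify ρ g x = ∫ t, ρ.normed volume (x - t) • g t :=
  convolution_eq_swap (lsmul ℝ ℝ)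

lemma contDiff_mollify (ρ : ContDiffBump (0 : 𝔼)) {g : 𝔼 → F} (hg : LocallyIntegrable g) :
    ContDiff ℝ ∞ (mollify ρ g) :=
  ρ.hasCompactSupport_normed.contDiff_convolution_left _ ρ.contDiff_normed hg

lemma integrable_normed_sub_smul (ρ : ContDiffBump (0 : 𝔼)) {g : 𝔼 → F}
    (hg : LocallyIntegrable g) (x : 𝔼) :
    Integrable (fun t => ρ.normed volume t • g (x - t)) :=
  ρ.hasCompactSupport_normed.convolutionExists_left (lsmul ℝ ℝ) ρ.continuous_normed hg x

lemma mollify_sub (ρ : ContDiffBump (0 : 𝔼)) {g h : 𝔼 → F} (hg : LocallyIntegrable g)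
    (hh : LocallyIntegrable h) : mollify ρ (g - h) = mollify ρ g - mollify ρ h := by
  ext x
  simp only [mollify_apply, Pi.sub_apply, smul_sub]
  exact integral_sub (integrable_normed_sub_smul ρ hg x) (integrable_normed_sub_smul ρ hh x)

lemma mollify_eq_zero (ρ : ContDiffBump (0 : 𝔼)) {g : 𝔼 → F} {s : Set 𝔼}
    (hg : ∀ x ∉ s, g x = 0) {x : 𝔼} (hx : x ∉ cthickening ρ.rOut s) : mollify ρ g x = 0 := by
  rw [mollify_apply']
  refine integral_eq_zero_of_ae (.of_forall fun t => ?_)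
  by_cases ht : t ∈ s
  · have : ρ.normed volume (x - t) = 0 := by
      rw [← Function.notMem_support, ρ.support_normed_eq]
      intro h
      refine hx (mem_cthickening_of_dist_le x t _ _ ht ?_)
      rw [mem_ball_zero_iff] at h
      rw [dist_eq_norm]
      exact h.le
    simp [this]
  · simp [hg t ht]

/-- The normalised bump is a probability density, so this is Jensen's inequality, obtained here from
the monotonicity of `L^s` norms on a probability space. -/
lemma enorm_mollify_rpow_le [CompleteSpace F] (ρ : ContDiffBump (0 : 𝔼)) {g : 𝔼 → F}
    (hg : StronglyMeasurable g) {s : ℝ} (hs : 1 ≤ s) (x : 𝔼) :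
    ‖mollify ρ g x‖ₑ ^ s ≤ ∫⁻ t, ‖ρ.normed volume t‖ₑ * ‖g (x - t)‖ₑ ^ s := by
  have hs0 : 0 < s := one_pos.trans_le hs
  have hm : Measurable fun t : 𝔼 => ‖ρ.normed volume t‖ₑ := ρ.continuous_normed.measurable.enorm
  have hgm : Measurable fun t : 𝔼 => ‖g (x - t)‖ₑ :=
    (hg.comp_measurable (measurable_const.sub measurable_id)).enorm
  set ν : Measure 𝔼 := volume.withDensity fun t => ‖ρ.normed volume t‖ₑ
  have : IsProbabilityMeasure ν := by
    constructor
    rw [withDensity_apply _ MeasurableSet.univ, Measure.restrict_univ]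
    rw [← ofReal_integral_norm_eq_lintegral_enorm ρ.integrable_normed]
    simp_rw [Real.norm_of_nonneg (ρ.nonneg_normed _)]
    rw [ρ.integral_normed, ENNReal.ofReal_one]
  have h1 : ‖mollify ρ g x‖ₑ ≤ ∫⁻ t, ‖g (x - t)‖ₑ ∂ν := by
    rw [lintegral_withDensity_eq_lintegral_mul _ hm hgm, mollify_apply]
    refine (enorm_integral_le_lintegral_enorm _).trans (le_of_eq ?_)
    exact lintegral_congr fun t => enorm_smul _ _
  have h2 : ∫⁻ t, ‖g (x - t)‖ₑ ∂ν ≤ (∫⁻ t, ‖g (x - t)‖ₑ ^ s ∂ν) ^ (1 / s) := by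
    have := eLpNorm'_le_eLpNorm'_of_exponent_le (f := fun t => g (x - t)) (μ := ν)
      one_pos hs (hg.comp_measurable (measurable_const.sub measurable_id)).aestronglyMeasurable
    simpa [eLpNorm'] using this
  calc ‖mollify ρ g x‖ₑ ^ s ≤ ((∫⁻ t, ‖g (x - t)‖ₑ ^ s ∂ν) ^ (1 / s)) ^ s := by
        gcongr; exact h1.trans h2
    _ = ∫⁻ t, ‖g (x - t)‖ₑ ^ s ∂ν := by
        rw [← ENNReal.rpow_mul, one_div_mul_cancel hs0.ne', ENNReal.rpow_one]
    _ = _ := by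
        rw [lintegral_withDensity_eq_lintegral_mul _ hm (hgm.pow_const s)]
        rfl

/-- Young's inequality for mollifications. -/
lemma eLpNorm_mollify_le [CompleteSpace F] (ρ : ContDiffBump (0 : 𝔼)) {g : 𝔼 → F} {s : ℝ≥0∞}
    (hs : 1 ≤ s) (hs' : s ≠ ⊤) (hg : AEStronglyMeasurable g) :
    eLpNorm (mollify ρ g) s volume ≤ eLpNorm g s volume := by
  have hs1 : 1 ≤ s.toReal := by
    rw [← ENNReal.toReal_one]; exact ENNReal.toReal_mono hs' hs
  rw [mollify_congr ρ hg.ae_eq_mk, eLpNorm_congr_ae hg.ae_eq_mk]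
  set h := hg.mk g
  have hh : StronglyMeasurable h := hg.stronglyMeasurable_mk
  rw [eLpNorm_eq_lintegral_rpow_enorm_toReal (one_pos.trans_le hs).ne' hs',
    eLpNorm_eq_lintegral_rpow_enorm_toReal (one_pos.trans_le hs).ne' hs']
  refine ENNReal.rpow_le_rpow ?_ (by positivity)
  have hm : Measurable fun t : 𝔼 => ‖ρ.normed volume t‖ₑ := ρ.continuous_normed.measurable.enorm
  calc ∫⁻ x, ‖mollify ρ h x‖ₑ ^ s.toReal
      ≤ ∫⁻ x, ∫⁻ t, ‖ρ.normed volume t‖ₑ * ‖h (x - t)‖ₑ ^ s.toReal :=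
        lintegral_mono fun x => enorm_mollify_rpow_le ρ hh hs1 x
    _ = ∫⁻ t, ∫⁻ x, ‖ρ.normed volume t‖ₑ * ‖h (x - t)‖ₑ ^ s.toReal := by
        refine lintegral_lintegral_swap (Measurable.aemeasurable ?_)
        exact (hm.comp measurable_snd).mul
          ((hh.enorm.comp (measurable_fst.sub measurable_snd)).pow_const _)
    _ = ∫⁻ t, ‖ρ.normed volume t‖ₑ * ∫⁻ x, ‖h x‖ₑ ^ s.toReal := by
        refine lintegral_congr fun t => ?_
        rw [lintegral_const_mul' _ _ enorm_ne_top]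
        rw [lintegral_sub_right_eq_self (fun x => ‖h x‖ₑ ^ s.toReal) t]
    _ = ∫⁻ x, ‖h x‖ₑ ^ s.toReal := by
        rw [lintegral_mul_const _ hm, ← ofReal_integral_norm_eq_lintegral_enorm ρ.integrable_normed]
        simp_rw [Real.norm_of_nonneg (ρ.nonneg_normed _)]
        rw [ρ.integral_normed, ENNReal.ofReal_one, one_mul]

/-- A sequence of bump functions shrinking to the origin. -/
noncomputable def bumpSeq (d k : ℕ) : ContDiffBump (0 : EuclideanSpace ℝ (Fin d)) where
  rIn := 1 / ((k : ℝ) + 1)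
  rOut := 2 / ((k : ℝ) + 1)
  rIn_pos := by positivity
  rIn_lt_rOut := by gcongr; norm_num

lemma tendsto_bumpSeq_rOut (d : ℕ) : Tendsto (fun k => (bumpSeq d k).rOut) atTop (𝓝 0) := by
  have := (tendsto_one_div_add_atTop_nhds_zero_nat (𝕜 := ℝ)).const_mul 2
  simpa [bumpSeq, div_eq_mul_inv] using this

lemma bumpSeq_rOut_le (d k : ℕ) : (bumpSeq d k).rOut ≤ 2 := by
  simp only [bumpSeq]
  rw [div_le_iff₀ (by positivity)]
  linarith [(Nat.cast_nonneg k : (0 : ℝ) ≤ k)]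

/-- Lebesgue differentiation needs the ratio of outer to inner radius to stay bounded; for `bumpSeq`
it is always 2. -/
lemma tendsto_mollify_bumpSeq_ae [CompleteSpace F] {g : 𝔼 → F} (hg : LocallyIntegrable g) :
    ∀ᵐ x, Tendsto (fun k => mollify (bumpSeq n k) g x) atTop (𝓝 (g x)) := by
  refine ContDiffBump.ae_convolution_tendsto_right_of_locallyIntegrable (K := 2)
    (tendsto_bumpSeq_rOut n) (.of_forall fun k => ?_) hg
  simp [bumpSeq, div_eq_mul_inv]

/-- Uniform continuity makes the difference uniformly small, and since all outer radii are at most 2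
it is supported in one fixed compact set. -/
lemma tendsto_eLpNorm_mollify_bumpSeq_sub_of_continuous [CompleteSpace F] {g : 𝔼 → F} {s : ℝ≥0∞}
    (hs' : s ≠ ⊤) (hc : Continuous g) (hg : HasCompactSupport g) :
    Tendsto (fun k => eLpNorm (mollify (bumpSeq n k) g - g) s volume) atTop (𝓝 0) := by
  set T : Set 𝔼 := cthickening 2 (tsupport g)
  have hT : IsCompact T := hg.isCompact.cthickening
  have hTm : volume T ^ (1 / s.toReal) ≠ ⊤ :=
    (ENNReal.rpow_lt_top_of_nonneg (by positivity) hT.measure_lt_top.ne).ne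
  have hgT : tsupport g ⊆ T := self_subset_cthickening _
  have hlim : Tendsto (fun ε : ℝ => ENNReal.ofReal ε * volume T ^ (1 / s.toReal)) (𝓝[>] 0)
      (𝓝 0) := by
    have h0 : Tendsto (fun ε : ℝ => ENNReal.ofReal ε) (𝓝[>] 0) (𝓝 0) := by
      have := (ENNReal.continuous_ofReal.tendsto (0 : ℝ)).mono_left
        (nhdsWithin_le_nhds (s := Ioi (0 : ℝ)))
      simpa using this
    have := ENNReal.Tendsto.mul_const h0 (Or.inr hTm)
    simpa using this
  rw [ENNReal.tendsto_nhds_zero]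
  intro δ hδ
  obtain ⟨ε, hεδ, hε⟩ := ((ENNReal.tendsto_nhds_zero.1 hlim δ hδ).and
    self_mem_nhdsWithin).exists
  have hε : 0 < ε := hε
  obtain ⟨r, hr, hu⟩ := Metric.uniformContinuous_iff.1
    (hg.uniformContinuous_of_continuous hc) ε hε
  filter_upwards [(tendsto_bumpSeq_rOut n).eventually (gt_mem_nhds hr)] with k hk
  refine (eLpNorm_sub_le_of_dist_bdd volume hs' hT.measurableSet hε.le (fun x => ?_) ?_
    ((subset_tsupport _).trans hgT)).trans hεδ
  · refine (bumpSeq n k).dist_normed_convolution_le hc.aestronglyMeasurable fun y hy => ?_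
    exact (hu ((mem_ball.1 hy).trans hk)).le
  · intro x hx
    by_contra hxT
    refine hx (mollify_eq_zero _ (s := tsupport g) (fun y hy => image_eq_zero_of_notMem_tsupport hy)
      fun h => hxT (cthickening_mono (bumpSeq_rOut_le n k) _ h))

/-- Continuous functions with compact support are dense, and mollification does not increase the
norm. -/
lemma tendsto_eLpNorm_mollify_bumpSeq_sub [CompleteSpace F] {g : 𝔼 → F} {s : ℝ≥0∞}
    (hs : 1 ≤ s) (hs' : s ≠ ⊤) (hg : MemLp g s) :
    Tendsto (fun k => eLpNorm (mollify (bumpSeq n k) g - g) s volume) atTop (𝓝 0) := by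
  rw [ENNReal.tendsto_nhds_zero]
  intro δ hδ
  have h3 : δ / 3 ≠ 0 := (ENNReal.div_pos hδ.ne' (by norm_num)).ne'
  obtain ⟨h, hhc, hgh, hh, hhL⟩ := hg.exists_hasCompactSupport_eLpNorm_sub_le hs' h3
  filter_upwards [ENNReal.tendsto_nhds_zero.1
    (tendsto_eLpNorm_mollify_bumpSeq_sub_of_continuous hs' hh hhc) (δ / 3) h3.bot_lt] with k hk
  have hgl : LocallyIntegrable g := hg.locallyIntegrable hs
  have hhl : LocallyIntegrable h := hh.locallyIntegrable
  have hsub : LocallyIntegrable (g - h) := hgl.sub hhl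
  have e : mollify (bumpSeq n k) g - g
      = (mollify (bumpSeq n k) (g - h) + (mollify (bumpSeq n k) h - h)) + (h - g) := by
    rw [mollify_sub _ hgl hhl]; abel
  have m1 := (contDiff_mollify (bumpSeq n k) hsub).continuous.aestronglyMeasurable (μ := volume)
  have m2 := (contDiff_mollify (bumpSeq n k) hhl).continuous.aestronglyMeasurable (μ := volume)
  rw [e]
  refine (eLpNorm_add_le (m1.add (m2.sub hhL.1)) (hhL.1.sub hg.1) hs).trans ?_
  refine (add_le_add (eLpNorm_add_le m1 (m2.sub hhL.1) hs) le_rfl).trans ?_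
  calc _ ≤ δ / 3 + δ / 3 + δ / 3 := by
        gcongr
        · exact (eLpNorm_mollify_le _ hs hs' (hg.1.sub hhL.1)).trans hgh
        · rw [eLpNorm_sub_comm]; exact hgh
    _ = δ := ENNReal.add_thirds δ

/-! ### Test functions -/

namespace IsTestFunction

variable {U V : Set (EuclideanSpace ℝ (Fin n))} {η θ : EuclideanSpace ℝ (Fin n) → ℝ}

lemma mono (h : IsTestFunction U η) (hUV : U ⊆ V) : IsTestFunction V η :=
  ⟨h.1, h.2.1, h.2.2.trans hUV⟩

lemma differentiable (h : IsTestFunction U η) : Differentiable ℝ η := h.1.differentiable (by simp)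

lemma continuous_fderiv (h : IsTestFunction U η) : Continuous (fderiv ℝ η) :=
  h.1.continuous_fderiv (by simp)

lemma mul (h : IsTestFunction U η) (hθ : ContDiff ℝ ∞ θ) : IsTestFunction U fun x => η x * θ x :=
  ⟨h.1.mul hθ, h.2.1.mul_right, (tsupport_mul_subset_left).trans h.2.2⟩

lemma comp (h : IsTestFunction U η) {G : ℝ → ℝ} (hG : ContDiff ℝ ∞ G) (h0 : G 0 = 0) :
    IsTestFunction U fun x => G (η x) :=
  ⟨hG.comp h.1, h.2.1.comp_left h0, (closure_mono (Function.support_comp_subset h0 η)).trans h.2.2⟩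

lemma eq_zero (h : IsTestFunction U η) {x : 𝔼} (hx : x ∉ U) : η x = 0 :=
  image_eq_zero_of_notMem_tsupport fun hx' => hx (h.2.2 hx')

lemma fderiv_eq_zero_of_notMem (h : IsTestFunction U η) {x : 𝔼} (hx : x ∉ U) : fderiv ℝ η x = 0 :=
  fderiv_of_notMem_tsupport ℝ fun hx' => hx (h.2.2 hx')

end IsTestFunction

/-- A cut-off function equal to `1` near a compact subset of an open set. -/
lemma exists_isTestFunction_eq_one {U K : Set 𝔼} (hU : IsOpen U) (hK : IsCompact K) (hKU : K ⊆ U) :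
    ∃ (χ : 𝔼 → ℝ) (V : Set 𝔼), IsTestFunction U χ ∧ IsOpen V ∧ K ⊆ V ∧ V ⊆ U ∧
      ∀ x ∈ V, χ x = 1 := by
  obtain ⟨L, hL, hKL, hLU⟩ := exists_compact_between hK hU hKU
  obtain ⟨L', hL', hLL', hL'U⟩ := exists_compact_between hL hU hLU
  obtain ⟨χ, hχ, -, hs, h1⟩ := exists_contMDiff_support_eq_eq_one_iff (n := ⊤)
    (modelWithCornersSelf ℝ 𝔼) isOpen_interior hL.isClosed hLL'
  have hts : tsupport χ ⊆ L' := by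
    rw [tsupport, hs]
    exact closure_minimal interior_subset hL'.isClosed
  refine ⟨χ, interior L, ⟨hχ.contDiff, hL'.of_isClosed_subset (isClosed_tsupport _) hts,
    hts.trans hL'U⟩, isOpen_interior, hKL, interior_subset.trans hLU, fun x hx => ?_⟩
  exact (h1 x).1 (interior_subset hx)

lemma integrable_smul_of_tsupport_subset {U : Set 𝔼} {θ : 𝔼 → ℝ} {g : 𝔼 → F} (hθ : Continuous θ)
    (hc : HasCompactSupport θ) (hs : tsupport θ ⊆ U) (hg : LocallyIntegrableOn g U) :
    Integrable fun x => θ x • g x := by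
  have h1 : IntegrableOn (fun x => θ x • g x) (tsupport θ) :=
    (hg.integrableOn_compact_subset hs hc.isCompact).continuousOn_smul hθ.continuousOn hc.isCompact
  refine (integrableOn_iff_integrable_of_support_subset fun x hx => ?_).1 h1
  refine subset_tsupport _ fun h0 => hx ?_
  simp [h0]

lemma IsTestFunction.integrable_smul {U : Set 𝔼} {η : 𝔼 → ℝ} (h : IsTestFunction U η) {g : 𝔼 → F}
    (hg : LocallyIntegrableOn g U) : Integrable fun x => η x • g x :=
  integrable_smul_of_tsupport_subset h.1.continuous h.2.1 h.2.2 hg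

lemma IsTestFunction.fderiv_apply {U : Set 𝔼} {η : 𝔼 → ℝ} (h : IsTestFunction U η) (v : 𝔼) :
    IsTestFunction U fun x => fderiv ℝ η x v := by
  refine ⟨?_, h.2.1.fderiv_apply ℝ v, (tsupport_fderiv_apply_subset ℝ v).trans h.2.2⟩
  exact (h.1.fderiv_right (m := ∞) (by simp)).clm_apply contDiff_const

lemma IsTestFunction.exists_bound {U : Set 𝔼} {η : 𝔼 → ℝ} (h : IsTestFunction U η) :
    ∃ c : ℝ, ∀ x, ‖η x‖ ≤ c :=
  h.2.1.exists_bound_of_continuous h.1.continuous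

/-! ### Calculus of weak derivatives -/

namespace HasWeakFDeriv

variable {U V : Set (EuclideanSpace ℝ (Fin n))}

/-- Test functions vanish off `U`, so the defining identity can be read on the whole space, where
shrinking `U` or changing functions off `U` costs nothing. -/
lemma integral_eq {u : 𝔼 → F} {Du : 𝔼 → 𝔼 →L[ℝ] F} (h : HasWeakFDeriv U u Du) {η : 𝔼 → ℝ}
    (hη : IsTestFunction U η) (v : 𝔼) :
    ∫ x, fderiv ℝ η x v • u x = -∫ x, η x • Du x v := by
  have := h.2.2 η hη v
  rwa [setIntegral_eq_integral_of_forall_compl_eq_zero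
      (fun x hx => by simp [hη.fderiv_eq_zero_of_notMem hx]),
    setIntegral_eq_integral_of_forall_compl_eq_zero
      (fun x hx => by simp [hη.eq_zero hx])] at this

lemma of_integral_eq {u : 𝔼 → F} {Du : 𝔼 → 𝔼 →L[ℝ] F} (hu : LocallyIntegrableOn u U)
    (hDu : LocallyIntegrableOn Du U) (h : ∀ η : 𝔼 → ℝ, IsTestFunction U η → ∀ v : 𝔼,
      ∫ x, fderiv ℝ η x v • u x = -∫ x, η x • Du x v) : HasWeakFDeriv U u Du := by
  refine ⟨hu, hDu, fun η hη v => ?_⟩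
  rw [setIntegral_eq_integral_of_forall_compl_eq_zero
      (fun x hx => by simp [hη.fderiv_eq_zero_of_notMem hx]),
    setIntegral_eq_integral_of_forall_compl_eq_zero
      (fun x hx => by simp [hη.eq_zero hx])]
  exact h η hη v

lemma mono {u : 𝔼 → F} {Du : 𝔼 → 𝔼 →L[ℝ] F} (h : HasWeakFDeriv U u Du) (hVU : V ⊆ U) :
    HasWeakFDeriv V u Du :=
  of_integral_eq (h.1.mono_set hVU) (h.2.1.mono_set hVU) fun _ hη v => h.integral_eq (hη.mono hVU) v

lemma congr_on {u u' : 𝔼 → F} {Du Du' : 𝔼 → 𝔼 →L[ℝ] F} (h : HasWeakFDeriv U u Du)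
    (hU : MeasurableSet U) (hu : EqOn u u' U) (hDu : EqOn Du Du' U) : HasWeakFDeriv U u' Du' := by
  refine of_integral_eq (h.1.congr (hu.aeEq_restrict hU)) (h.2.1.congr (hDu.aeEq_restrict hU)) fun η hη v => ?_
  have e := h.integral_eq hη v
  convert e using 2
  · ext x
    by_cases hx : x ∈ U
    · rw [hu hx]
    · simp [hη.fderiv_eq_zero_of_notMem hx]
  · congr 1
    ext x
    by_cases hx : x ∈ U
    · rw [hDu hx]
    · simp [hη.eq_zero hx]

lemma of_contDiff {u : 𝔼 → ℝ} (hu : ContDiff ℝ ∞ u) : HasWeakFDeriv U u (fderiv ℝ u) := by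
  have hd := hu.continuous_fderiv (by simp)
  refine of_integral_eq (hu.continuous.locallyIntegrable.locallyIntegrableOn U)
    (hd.locallyIntegrable.locallyIntegrableOn U) fun η hη v => ?_
  simp only [smul_eq_mul]
  have hη' := hη.mono (subset_univ U)
  have hl : ∀ {g : 𝔼 → ℝ}, Continuous g → LocallyIntegrableOn g univ := fun hg =>
    hg.locallyIntegrable.locallyIntegrableOn univ
  have i1 := (hη'.fderiv_apply v).integrable_smul (hl hu.continuous)
  have i2 := hη'.integrable_smul (hl (hd.clm_apply continuous_const) : LocallyIntegrableOn
    (fun x => fderiv ℝ u x v) univ)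
  have i3 := hη'.integrable_smul (hl hu.continuous)
  rw [integral_mul_fderiv_eq_neg_fderiv_mul_of_integrable i1 i2 i3
    (fun x _ => hη.differentiable x) (fun x _ => hu.differentiable (by simp) x), neg_neg]

lemma clm_comp {G : Type*} [NormedAddCommGroup G] [NormedSpace ℝ G] [CompleteSpace F]
    [CompleteSpace G] {u : 𝔼 → F} {Du : 𝔼 → 𝔼 →L[ℝ] F} (h : HasWeakFDeriv U u Du) (ℓ : F →L[ℝ] G) :
    HasWeakFDeriv U (fun x => ℓ (u x)) (fun x => ℓ.comp (Du x)) := by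
  have h1 : LocallyIntegrableOn (fun x => ℓ (u x)) U := fun x hx => by
    obtain ⟨s, hs, hi⟩ := h.1 x hx
    exact ⟨s, hs, ℓ.integrable_comp hi⟩
  have h2 : LocallyIntegrableOn (fun x => ℓ.comp (Du x)) U := fun x hx => by
    obtain ⟨s, hs, hi⟩ := h.2.1 x hx
    exact ⟨s, hs, (compL ℝ 𝔼 F G ℓ).integrable_comp hi⟩
  refine of_integral_eq h1 h2 fun η hη v => ?_
  have h3 : LocallyIntegrableOn (fun x => Du x v) U := fun x hx => by
    obtain ⟨s, hs, hi⟩ := h.2.1 x hx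
    exact ⟨s, hs, (ContinuousLinearMap.apply ℝ F v).integrable_comp hi⟩
  have e := congrArg ℓ (h.integral_eq hη v)
  rw [map_neg, ← ℓ.integral_comp_comm ((hη.fderiv_apply v).integrable_smul h.1),
    ← ℓ.integral_comp_comm (hη.integrable_smul h3)] at e
  simpa using e

/-- The difference of the two derivatives integrates to zero against every test function, so the
fundamental lemma of the calculus of variations applies. -/
lemma ae_eq [CompleteSpace F] {u : 𝔼 → F} {Du Du' : 𝔼 → 𝔼 →L[ℝ] F} (hU : IsOpen U)
    (h : HasWeakFDeriv U u Du) (h' : HasWeakFDeriv U u Du') : Du =ᵐ[volume.restrict U] Du' := by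
  have hl : LocallyIntegrableOn (fun x => Du x - Du' x) U := h.2.1.sub h'.2.1
  have := hU.ae_eq_zero_of_integral_contDiff_smul_eq_zero hl fun η h1 h2 h3 => by
    have hη : IsTestFunction U η := ⟨h1, h2, h3⟩
    have hi := hη.integrable_smul hl
    ext v
    rw [ContinuousLinearMap.integral_apply hi]
    have e := (h.integral_eq hη v).symm.trans (h'.integral_eq hη v)
    have i1 := (hη.integrable_smul h.2.1).apply_continuousLinearMap v
    have i2 := (hη.integrable_smul h'.2.1).apply_continuousLinearMap v
    have e2 := integral_sub i1 i2
    simp only [smul_sub, sub_apply, smul_apply, zero_apply] at e2 ⊢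
    rw [e2, sub_eq_zero]
    exact neg_injective e
  rw [Filter.EventuallyEq, ae_restrict_iff' hU.measurableSet]
  filter_upwards [this] with x hx hxU
  exact sub_eq_zero.1 (hx hxU)

end HasWeakFDeriv

/-- Serves both sides of the integration by parts formula: `ℓ` is the identity for the functions and
evaluation at `v` for the derivatives. -/
lemma IsTestFunction.tendsto_integral_smul {G : Type*} [NormedAddCommGroup G] [NormedSpace ℝ G]
    {U : Set 𝔼} {θ : 𝔼 → ℝ} (hθ : IsTestFunction U θ) (ℓ : F →L[ℝ] G) {w : ℕ → 𝔼 → F} {w' : 𝔼 → F}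
    (hw : ∀ k, LocallyIntegrableOn (w k) U) (hw' : LocallyIntegrableOn w' U)
    (h : Tendsto (fun k => eLpNorm (w k - w') 1 (volume.restrict U)) atTop (𝓝 0)) :
    Tendsto (fun k => ∫ x in U, θ x • ℓ (w k x)) atTop (𝓝 (∫ x in U, θ x • ℓ (w' x))) := by
  obtain ⟨c, hc⟩ := hθ.exists_bound
  have hi : ∀ {g : 𝔼 → F}, LocallyIntegrableOn g U → IntegrableOn (fun x => θ x • ℓ (g x)) U := by
    intro g hg
    have := ℓ.integrable_comp (hθ.integrable_smul hg)
    simpa using this.integrableOn (s := U)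
  refine tendsto_integral_of_L1' _ (hi hw').1 (.of_forall fun k => hi (hw k)) ?_
  have hub : ∀ k, eLpNorm ((fun x => θ x • ℓ (w k x)) - fun x => θ x • ℓ (w' x)) 1
      (volume.restrict U) ≤
      ENNReal.ofReal (c * ‖ℓ‖) * eLpNorm (w k - w') 1 (volume.restrict U) := by
    intro k
    refine eLpNorm_le_mul_eLpNorm_of_ae_le_mul (.of_forall fun x => ?_) 1
    simp only [Pi.sub_apply]
    rw [← smul_sub, ← map_sub, norm_smul, mul_assoc]
    have hc0 : 0 ≤ c := (norm_nonneg _).trans (hc x)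
    gcongr
    · exact hc x
    · exact ℓ.le_opNorm _
  refine tendsto_of_tendsto_of_tendsto_of_le_of_le tendsto_const_nhds ?_ (fun _ => bot_le) hub
  simpa using ENNReal.Tendsto.const_mul h (Or.inr ENNReal.ofReal_ne_top)

/-- Weak derivatives are closed under `L¹` convergence. -/
lemma HasWeakFDeriv.of_tendsto [CompleteSpace F] {U : Set 𝔼} {w : ℕ → 𝔼 → F}
    {Dw : ℕ → 𝔼 → 𝔼 →L[ℝ] F} {u : 𝔼 → F} {Du : 𝔼 → 𝔼 →L[ℝ] F}
    (h : ∀ k, HasWeakFDeriv U (w k) (Dw k))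
    (hu : LocallyIntegrableOn u U) (hDu : LocallyIntegrableOn Du U)
    (h1 : Tendsto (fun k => eLpNorm (w k - u) 1 (volume.restrict U)) atTop (𝓝 0))
    (h2 : Tendsto (fun k => eLpNorm (Dw k - Du) 1 (volume.restrict U)) atTop (𝓝 0)) :
    HasWeakFDeriv U u Du := by
  refine ⟨hu, hDu, fun η hη v => ?_⟩
  have t1 := (hη.fderiv_apply v).tendsto_integral_smul (ContinuousLinearMap.id ℝ F)
    (fun k => (h k).1) hu h1
  have t2 := hη.tendsto_integral_smul (ContinuousLinearMap.apply ℝ F v)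
    (fun k => (h k).2.1) hDu h2
  refine tendsto_nhds_unique t1 (t2.neg.congr fun k => ?_)
  exact ((h k).2.2 η hη v).symm

lemma HasWeakFDeriv.integrable_cutoff {U : Set 𝔼} {u : 𝔼 → ℝ} {Du : 𝔼 → 𝔼 →L[ℝ] ℝ}
    (h : HasWeakFDeriv U u Du) {χ : 𝔼 → ℝ} (hχ : IsTestFunction U χ) :
    Integrable fun x => χ x • Du x + u x • fderiv ℝ χ x := by
  have hi2 : Integrable fun x => χ x • Du x := hχ.integrable_smul h.2.1
  have hi3 : Integrable fun x => u x • fderiv ℝ χ x := by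
    have h1 : IntegrableOn (fun x => u x • fderiv ℝ χ x) (tsupport χ) :=
      (h.1.integrableOn_compact_subset hχ.2.2 hχ.2.1.isCompact).smul_continuousOn
        hχ.continuous_fderiv.continuousOn hχ.2.1.isCompact
    refine (integrableOn_iff_integrable_of_support_subset
      (f := fun x => u x • fderiv ℝ χ x) (s := tsupport χ) fun x hx => ?_).1 h1
    by_contra h0
    exact hx (by simp [fderiv_of_notMem_tsupport ℝ h0])
  have := Integrable.add (ε' := 𝔼 →L[ℝ] ℝ) hi2 hi3
  exact this

/-- Multiplication by a cut-off function. -/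
lemma HasWeakFDeriv.cutoff {U : Set 𝔼} {u : 𝔼 → ℝ} {Du : 𝔼 → 𝔼 →L[ℝ] ℝ} (h : HasWeakFDeriv U u Du)
    {χ : 𝔼 → ℝ} (hχ : IsTestFunction U χ) :
    HasWeakFDeriv univ (fun x => χ x * u x) (fun x => χ x • Du x + u x • fderiv ℝ χ x) := by
  have hi1 : Integrable fun x => χ x * u x := hχ.integrable_smul h.1
  refine .of_integral_eq (hi1.locallyIntegrable.locallyIntegrableOn _)
    ((h.integrable_cutoff hχ).locallyIntegrable.locallyIntegrableOn _) fun η hη v => ?_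
  have e := h.integral_eq (hχ.mul hη.1) v
  have hp : ∀ x, fderiv ℝ (fun x => χ x * η x) x v
      = χ x * fderiv ℝ η x v + η x * fderiv ℝ χ x v := fun x => by
    rw [fderiv_fun_mul (hχ.differentiable x) (hη.differentiable x)]
    simp
  simp only [hp, smul_eq_mul, add_apply, smul_apply, add_mul, mul_add] at e ⊢
  have hχη := hχ.mul hη.1
  have j1 : Integrable fun x => χ x * fderiv ℝ η x v * u x :=
    ((hχ.mul (hη.fderiv_apply v).1).integrable_smul h.1)
  have j2 : Integrable fun x => η x * fderiv ℝ χ x v * u x := by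
    have := (((hχ.fderiv_apply v).mul hη.1).integrable_smul h.1)
    simpa [mul_comm] using this
  have j3 : Integrable fun x => χ x * η x * Du x v := by
    simpa using (hχη.integrable_smul h.2.1).apply_continuousLinearMap v
  rw [integral_add j1 j2] at e
  have e1 : ∫ x, fderiv ℝ η x v * (χ x * u x) = ∫ x, χ x * fderiv ℝ η x v * u x :=
    integral_congr_ae (.of_forall fun x => by ring)
  have e2 : ∫ x, (η x * (χ x * Du x v) + η x * (u x * fderiv ℝ χ x v))
      = (∫ x, χ x * η x * Du x v) + ∫ x, η x * fderiv ℝ χ x v * u x := by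
    rw [← integral_add j3 j2]
    exact integral_congr_ae (.of_forall fun x => by ring)
  rw [e1, e2]
  linarith

/-- The derivative falls on the kernel. As `t ↦ ρ (x - t)` is a test function, the weak formula
moves it onto `u`; the sign of the inner derivative cancels the sign of the integration by parts. -/
lemma fderiv_mollify {u : 𝔼 → ℝ} {Du : 𝔼 → 𝔼 →L[ℝ] ℝ} (h : HasWeakFDeriv univ u Du)
    (ρ : ContDiffBump (0 : 𝔼)) : fderiv ℝ (mollify ρ u) = mollify ρ Du := by
  have hu : LocallyIntegrable u := locallyIntegrableOn_univ.1 h.1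
  have hDu : LocallyIntegrable Du := locallyIntegrableOn_univ.1 h.2.1
  have hρ1 : ContDiff ℝ 1 (ρ.normed volume) := ρ.contDiff_normed (n := 1)
  ext x v
  rw [mollify, (ρ.hasCompactSupport_normed.hasFDerivAt_convolution_left _ hρ1 hu x).fderiv,
    convolution_eq_swap]
  have hd : Continuous (fderiv ℝ (ρ.normed volume)) := hρ1.continuous_fderiv (by simp)
  have hdc : HasCompactSupport (fderiv ℝ (ρ.normed volume)) :=
    ρ.hasCompactSupport_normed.fderiv ℝ
  have hint : Integrable fun t => (precompL 𝔼 (lsmul ℝ ℝ : ℝ →L[ℝ] ℝ →L[ℝ] ℝ)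
      (fderiv ℝ (ρ.normed volume) (x - t))) (u t) := by
    have := (hdc.convolutionExists_left (precompL 𝔼 (lsmul ℝ ℝ : ℝ →L[ℝ] ℝ →L[ℝ] ℝ)) hd hu) x
    exact (convolutionExistsAt_iff_integrable_swap (L := precompL 𝔼
      (lsmul ℝ ℝ : ℝ →L[ℝ] ℝ →L[ℝ] ℝ))).1 this
  rw [ContinuousLinearMap.integral_apply hint, mollify_apply']
  set η : 𝔼 → ℝ := fun t => ρ.normed volume (x - t)
  have hη : IsTestFunction univ η := by
    refine ⟨ρ.contDiff_normed.comp (contDiff_const.sub contDiff_id), ?_, subset_univ _⟩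
    exact ρ.hasCompactSupport_normed.comp_homeomorph (Homeomorph.subLeft x)
  have hη' : ∀ t, fderiv ℝ η t v = -fderiv ℝ (ρ.normed volume) (x - t) v := fun t => by
    have h1 : HasFDerivAt (fun t : 𝔼 => x - t) (-ContinuousLinearMap.id ℝ 𝔼) t :=
      (hasFDerivAt_id t).const_sub x
    have h2 := (hρ1.differentiable (by simp) (x - t)).hasFDerivAt.comp t h1
    have h3 : HasFDerivAt η _ t := h2
    rw [h3.fderiv]
    simp
  have e := h.integral_eq hη v
  rw [ContinuousLinearMap.integral_apply (hη.integrable_smul h.2.1)]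
  simp only [hη', smul_apply] at e ⊢
  simp only [neg_smul, integral_neg] at e
  rw [← neg_injective e]
  rfl

/-! ### Chain rule -/

/-- Split `a_k w_k - a' w' = a_k (w_k - w') + (a_k - a') w'`. The first term is small because `a_k`
is bounded, the second by dominated convergence, so almost everywhere convergence of the bounded
factors suffices. -/
lemma tendsto_eLpNorm_smul_sub {X : Type*} [MeasurableSpace X] {μ : Measure X} {s : ℝ≥0∞}
    (hs : 1 ≤ s) (hs' : s ≠ ⊤) {a : ℕ → X → ℝ} {a' : X → ℝ} {w : ℕ → X → F} {w' : X → F} {c : ℝ}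
    (ham : ∀ k, AEStronglyMeasurable (a k) μ) (hac : ∀ k x, |a k x| ≤ c) (hac' : ∀ x, |a' x| ≤ c)
    (hat : ∀ᵐ x ∂μ, Tendsto (fun k => a k x) atTop (𝓝 (a' x)))
    (hwm : ∀ k, AEStronglyMeasurable (w k) μ) (hw' : MemLp w' s μ)
    (hw : Tendsto (fun k => eLpNorm (w k - w') s μ) atTop (𝓝 0)) :
    Tendsto (fun k => eLpNorm ((fun x => a k x • w k x) - fun x => a' x • w' x) s μ) atTop
      (𝓝 0) := by
  have ham' : AEStronglyMeasurable a' μ := aestronglyMeasurable_of_tendsto_ae atTop ham hat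
  have hs0 : s ≠ 0 := (one_pos.trans_le hs).ne'
  have hsp : 0 < s.toReal := ENNReal.toReal_pos hs0 hs'
  have h2 : Tendsto (fun k => eLpNorm (fun x => (a k x - a' x) • w' x) s μ) atTop (𝓝 0) := by
    have hl : Tendsto (fun k => ∫⁻ x, ‖(a k x - a' x) • w' x‖ₑ ^ s.toReal ∂μ) atTop
        (𝓝 (∫⁻ _, 0 ∂μ)) := by
      refine tendsto_lintegral_of_dominated_convergence'
        (fun x => ENNReal.ofReal (2 * c) ^ s.toReal * ‖w' x‖ₑ ^ s.toReal) (fun k => ?_)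
        (fun k => .of_forall fun x => ?_) ?_ ?_
      · exact (((ham k).sub ham').smul hw'.1).enorm.pow_const _
      · dsimp only
        rw [← ENNReal.mul_rpow_of_nonneg _ _ hsp.le]
        gcongr
        rw [enorm_smul]
        gcongr
        rw [← ofReal_norm, Real.norm_eq_abs]
        gcongr
        calc |a k x - a' x| ≤ |a k x| + |a' x| := abs_sub _ _
          _ ≤ 2 * c := by linarith [hac k x, hac' x]
      · rw [lintegral_const_mul' _ _ (ENNReal.rpow_ne_top_of_nonneg hsp.le ENNReal.ofReal_ne_top)]
        refine ENNReal.mul_ne_top (ENNReal.rpow_ne_top_of_nonneg hsp.le ENNReal.ofReal_ne_top) ?_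
        exact (lintegral_rpow_enorm_lt_top_of_eLpNorm_lt_top hs0 hs' hw'.2).ne
      · filter_upwards [hat] with x hx
        have h1 : Tendsto (fun k => (a k x - a' x) • w' x) atTop (𝓝 0) := by
          have := (hx.sub_const (a' x)).smul_const (w' x)
          simpa using this
        have h3 := (ENNReal.continuous_rpow_const (y := s.toReal)).continuousAt.tendsto.comp
          h1.enorm
        simpa [Function.comp_def, ENNReal.zero_rpow_of_pos hsp] using h3
    simp only [lintegral_zero] at hl
    have h3 := (ENNReal.continuous_rpow_const (y := 1 / s.toReal)).continuousAt.tendsto.comp hl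
    simp only [ENNReal.zero_rpow_of_pos (one_div_pos.2 hsp)] at h3
    refine h3.congr fun k => ?_
    rw [eLpNorm_eq_lintegral_rpow_enorm_toReal hs0 hs']
    rfl
  have hub : ∀ k, eLpNorm ((fun x => a k x • w k x) - fun x => a' x • w' x) s μ ≤
      ENNReal.ofReal c * eLpNorm (w k - w') s μ + eLpNorm (fun x => (a k x - a' x) • w' x) s μ := by
    intro k
    have e : ((fun x => a k x • w k x) - fun x => a' x • w' x)
        = (fun x => a k x • (w k - w') x) + fun x => (a k x - a' x) • w' x := by
      ext x
      simp only [Pi.sub_apply, Pi.add_apply, smul_sub, sub_smul]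
      abel
    rw [e]
    refine (eLpNorm_add_le ((ham k).smul ((hwm k).sub hw'.1))
      (((ham k).sub ham').smul hw'.1) hs).trans ?_
    refine add_le_add ?_ le_rfl
    refine eLpNorm_le_mul_eLpNorm_of_ae_le_mul (.of_forall fun x => ?_) s
    rw [Pi.smul_apply', norm_smul]
    gcongr
    exact hac k x
  refine tendsto_of_tendsto_of_tendsto_of_le_of_le tendsto_const_nhds ?_ (fun _ => bot_le) hub
  simpa using (ENNReal.Tendsto.const_mul hw (Or.inr ENNReal.ofReal_ne_top)).add h2

section Comp

variable {G : ℝ → ℝ} {L : ℝ}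

lemma abs_sub_le_of_abs_deriv_le (hG : ContDiff ℝ ∞ G) (hL : ∀ t, |deriv G t| ≤ L) (a b : ℝ) :
    |G a - G b| ≤ L * |a - b| :=
  convex_univ.norm_image_sub_le_of_norm_deriv_le (fun t _ => hG.differentiable (by simp) t)
    (fun t _ => hL t) (mem_univ b) (mem_univ a)

lemma fderiv_comp_real (hG : ContDiff ℝ ∞ G) {u : 𝔼 → ℝ} (hu : Differentiable ℝ u) :
    fderiv ℝ (fun x => G (u x)) = fun x => deriv G (u x) • fderiv ℝ u x := by
  ext x : 1
  exact ((hG.differentiable (by simp) (u x)).hasDerivAt.comp_hasFDerivAt x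
    (hu x).hasFDerivAt).fderiv

lemma tendsto_eLpNorm_comp_sub {X : Type*} [MeasurableSpace X] {μ : Measure X} {s : ℝ≥0∞}
    (hG : ContDiff ℝ ∞ G) (hL : ∀ t, |deriv G t| ≤ L) {u : ℕ → X → ℝ} {u' : X → ℝ}
    (h : Tendsto (fun k => eLpNorm (u k - u') s μ) atTop (𝓝 0)) :
    Tendsto (fun k => eLpNorm ((fun x => G (u k x)) - fun x => G (u' x)) s μ) atTop (𝓝 0) := by
  have hub : ∀ k, eLpNorm ((fun x => G (u k x)) - fun x => G (u' x)) s μ ≤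
      ENNReal.ofReal L * eLpNorm (u k - u') s μ := fun k =>
    eLpNorm_le_mul_eLpNorm_of_ae_le_mul
      (.of_forall fun x => abs_sub_le_of_abs_deriv_le hG hL (u k x) (u' x)) s
  refine tendsto_of_tendsto_of_tendsto_of_le_of_le tendsto_const_nhds ?_ (fun _ => bot_le) hub
  simpa using ENNReal.Tendsto.const_mul h (Or.inr ENNReal.ofReal_ne_top)

lemma locallyIntegrableOn_comp {U : Set 𝔼} (hG : ContDiff ℝ ∞ G) (hL : ∀ t, |deriv G t| ≤ L)
    {u : 𝔼 → ℝ} (hu : LocallyIntegrableOn u U) : LocallyIntegrableOn (fun x => G (u x)) U := by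
  intro x hx
  obtain ⟨s, hs, hi⟩ := hu x hx
  obtain ⟨t, ht, hit⟩ := (locallyIntegrable_const (μ := (volume : Measure 𝔼))
    (1 : ℝ)).locallyIntegrableOn U x hx
  refine ⟨s ∩ t, inter_mem hs ht, ?_⟩
  have h1 : IntegrableOn u (s ∩ t) := hi.mono_set inter_subset_left
  have h2 : IntegrableOn (fun _ : 𝔼 => (1 : ℝ)) (s ∩ t) := hit.mono_set inter_subset_right
  refine Integrable.mono' ((h2.const_mul |G 0|).add (h1.norm.const_mul L))
    (hG.continuous.comp_aestronglyMeasurable h1.1) (.of_forall fun y => ?_)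
  have := abs_sub_le_of_abs_deriv_le hG hL (u y) 0
  simp only [Pi.add_apply, Real.norm_eq_abs, mul_one]
  rw [sub_zero] at this
  linarith [abs_sub_abs_le_abs_sub (G (u y)) (G 0)]

lemma locallyIntegrableOn_deriv_comp_smul {U : Set 𝔼} (hG : ContDiff ℝ ∞ G)
    (hL : ∀ t, |deriv G t| ≤ L) {u : 𝔼 → ℝ} {w : 𝔼 → F} (hu : LocallyIntegrableOn u U)
    (hw : LocallyIntegrableOn w U) : LocallyIntegrableOn (fun x => deriv G (u x) • w x) U := by
  intro x hx
  obtain ⟨s, hs, hi⟩ := hu x hx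
  obtain ⟨t, ht, hit⟩ := hw x hx
  refine ⟨s ∩ t, inter_mem hs ht, ?_⟩
  have h1 : IntegrableOn u (s ∩ t) := hi.mono_set inter_subset_left
  have h2 : IntegrableOn w (s ∩ t) := hit.mono_set inter_subset_right
  refine Integrable.mono' (h2.norm.const_mul L)
    (((hG.continuous_deriv (by simp)).comp_aestronglyMeasurable h1.1).smul h2.1)
    (.of_forall fun y => ?_)
  rw [norm_smul]
  gcongr
  exact hL _

/-- The classical chain rule holds for the mollifications. In the limit, the functions converge
because `G` is Lipschitz, and the derivatives because `G'` is bounded and the mollifications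
converge almost everywhere. -/
lemma HasWeakFDeriv.comp_of_memLp {u : 𝔼 → ℝ} {Du : 𝔼 → 𝔼 →L[ℝ] ℝ} (hG : ContDiff ℝ ∞ G)
    (hL : ∀ t, |deriv G t| ≤ L) (h : HasWeakFDeriv univ u Du) (hu : MemLp u 1) (hDu : MemLp Du 1) :
    HasWeakFDeriv univ (fun x => G (u x)) (fun x => deriv G (u x) • Du x) := by
  have hl : LocallyIntegrable u := hu.locallyIntegrable le_rfl
  have hs : ∀ k, ContDiff ℝ ∞ (mollify (bumpSeq n k) u) := fun k => contDiff_mollify _ hl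
  have hD : ∀ k, fderiv ℝ (mollify (bumpSeq n k) u) = mollify (bumpSeq n k) Du := fun k =>
    fderiv_mollify h _
  have hG' := hG.continuous_deriv (by simp)
  refine HasWeakFDeriv.of_tendsto (w := fun k x => G (mollify (bumpSeq n k) u x))
    (Dw := fun k x => deriv G (mollify (bumpSeq n k) u x) • mollify (bumpSeq n k) Du x)
    (fun k => ?_) (locallyIntegrableOn_comp hG hL h.1)
    (locallyIntegrableOn_deriv_comp_smul hG hL h.1 h.2.1) ?_ ?_
  · have := HasWeakFDeriv.of_contDiff (U := univ) (hG.comp (hs k))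
    rw [Function.comp_def, fderiv_comp_real hG ((hs k).differentiable (by simp)), hD k] at this
    exact this
  · simp only [Measure.restrict_univ]
    exact tendsto_eLpNorm_comp_sub hG hL
      (tendsto_eLpNorm_mollify_bumpSeq_sub le_rfl ENNReal.one_ne_top hu)
  · simp only [Measure.restrict_univ]
    refine tendsto_eLpNorm_smul_sub le_rfl ENNReal.one_ne_top
      (fun k => (hG'.comp (hs k).continuous).aestronglyMeasurable) (fun _ _ => hL _) (fun _ => hL _)
      ?_ (fun k => ?_) hDu (tendsto_eLpNorm_mollify_bumpSeq_sub le_rfl ENNReal.one_ne_top hDu)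
    · filter_upwards [tendsto_mollify_bumpSeq_ae hl] with x hx
      exact (hG'.tendsto _).comp hx
    · rw [← hD k]
      exact ((hs k).continuous_fderiv (by simp)).aestronglyMeasurable

/-- Chain rule for weak derivatives. -/
lemma HasWeakFDeriv.comp {U : Set 𝔼} {u : 𝔼 → ℝ} {Du : 𝔼 → 𝔼 →L[ℝ] ℝ} (hU : IsOpen U)
    (hG : ContDiff ℝ ∞ G) (hL : ∀ t, |deriv G t| ≤ L) (h : HasWeakFDeriv U u Du) :
    HasWeakFDeriv U (fun x => G (u x)) (fun x => deriv G (u x) • Du x) := by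
  refine .of_integral_eq (locallyIntegrableOn_comp hG hL h.1)
    (locallyIntegrableOn_deriv_comp_smul hG hL h.1 h.2.1) fun η hη v => ?_
  -- Weak differentiability is tested by one `η` at a time, so `u` may be cut off outside a
  -- neighbourhood of the support of `η`; the cut-off function is globally integrable together with
  -- its derivative.
  obtain ⟨χ, V, hχ, hV, hKV, hVU, h1⟩ := exists_isTestFunction_eq_one hU hη.2.1.isCompact hη.2.2
  have hc := h.cutoff hχ
  have hm1 : MemLp (fun x => χ x * u x) 1 := memLp_one_iff_integrable.2 (hχ.integrable_smul h.1)
  have hm2 : MemLp (fun x => χ x • Du x + u x • fderiv ℝ χ x) 1 := by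
    rw [memLp_one_iff_integrable]
    exact h.integrable_cutoff hχ
  have hcomp := (hc.comp_of_memLp hG hL hm1 hm2).mono (subset_univ V)
  have hV2 : HasWeakFDeriv V (fun x => G (u x)) (fun x => deriv G (u x) • Du x) := by
    refine hcomp.congr_on hV.measurableSet (fun x hx => ?_) (fun x hx => ?_)
    · simp [h1 x hx]
    · have h0 : fderiv ℝ χ x = 0 := by
        have : χ =ᶠ[𝓝 x] fun _ => 1 := by
          filter_upwards [hV.mem_nhds hx] with y hy using h1 y hy
        rw [this.fderiv_eq]
        simp
      simp [h1 x hx, h0]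
  exact hV2.integral_eq ⟨hη.1, hη.2.1, hKV⟩ v

/-- Smooth functions of a limit of test functions are limits of test functions. -/
lemma exists_isTestFunction_tendsto_comp {U : Set 𝔼} {s : ℝ≥0∞} (hs : 1 ≤ s) (hs' : s ≠ ⊤)
    {u : 𝔼 → ℝ} {Du : 𝔼 → 𝔼 →L[ℝ] ℝ} (hu : AEStronglyMeasurable u (volume.restrict U))
    (hDu : MemLp Du s (volume.restrict U))
    (h : ∀ ε : ℝ≥0∞, 0 < ε → ∃ η : 𝔼 → ℝ, IsTestFunction U η ∧
      eLpNorm (fun x => u x - η x) s (volume.restrict U) < ε ∧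
      eLpNorm (fun x => Du x - fderiv ℝ η x) s (volume.restrict U) < ε)
    (hG : ContDiff ℝ ∞ G) (hL : ∀ t, |deriv G t| ≤ L) (h0 : G 0 = 0) :
    ∃ ζ : ℕ → 𝔼 → ℝ, (∀ k, IsTestFunction U (ζ k)) ∧
      Tendsto (fun k => eLpNorm (ζ k - fun x => G (u x)) s (volume.restrict U)) atTop (𝓝 0) ∧
      Tendsto (fun k => eLpNorm (fderiv ℝ (ζ k) - fun x => deriv G (u x) • Du x) s
        (volume.restrict U)) atTop (𝓝 0) ∧
      ∀ᵐ x ∂(volume.restrict U), Tendsto (fun k => ζ k x) atTop (𝓝 (G (u x))) := by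
  have hpos : ∀ k : ℕ, (0 : ℝ≥0∞) < ((k : ℝ≥0∞) + 1)⁻¹ := fun k =>
    ENNReal.inv_pos.2 (by finiteness)
  have hlim : Tendsto (fun k : ℕ => ((k : ℝ≥0∞) + 1)⁻¹) atTop (𝓝 0) := by
    have := (tendsto_add_atTop_iff_nat 1).2 ENNReal.tendsto_inv_nat_nhds_zero
    simpa using this
  choose η hη h1 h2 using fun k : ℕ => h _ (hpos k)
  have t1 : Tendsto (fun k => eLpNorm (η k - u) s (volume.restrict U)) atTop (𝓝 0) := by
    refine tendsto_of_tendsto_of_tendsto_of_le_of_le tendsto_const_nhds hlim (fun _ => bot_le)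
      fun k => ?_
    rw [eLpNorm_sub_comm]
    exact (h1 k).le
  have t2 : Tendsto (fun k => eLpNorm (fderiv ℝ (η k) - Du) s (volume.restrict U)) atTop (𝓝 0) := by
    refine tendsto_of_tendsto_of_tendsto_of_le_of_le tendsto_const_nhds hlim (fun _ => bot_le)
      fun k => ?_
    rw [eLpNorm_sub_comm]
    exact (h2 k).le
  -- Norm convergence gives almost everywhere convergence only along a subsequence, which is what
  -- the factor `G'` requires.
  obtain ⟨ns, hns, hae⟩ := (tendstoInMeasure_of_tendsto_eLpNorm (one_pos.trans_le hs).ne'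
    (fun k => (hη k).1.continuous.aestronglyMeasurable) hu t1).exists_seq_tendsto_ae
  have hG' := hG.continuous_deriv (by simp)
  refine ⟨fun k x => G (η (ns k) x), fun k => (hη _).comp hG h0, ?_, ?_, ?_⟩
  · exact tendsto_eLpNorm_comp_sub hG hL (t1.comp hns.tendsto_atTop)
  · simp only [fderiv_comp_real hG (hη _).differentiable]
    refine tendsto_eLpNorm_smul_sub hs hs'
      (fun k => (hG'.comp (hη _).1.continuous).aestronglyMeasurable) (fun _ _ => hL _)
      (fun _ => hL _) ?_ (fun k => (hη _).continuous_fderiv.aestronglyMeasurable) hDu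
      (t2.comp hns.tendsto_atTop)
    filter_upwards [hae] with x hx
    exact (hG'.tendsto _).comp hx
  · filter_upwards [hae] with x hx
    exact (hG.continuous.tendsto _).comp hx

end Comp

/-! ### The Jacobian as a null Lagrangian -/

/-- The determinant of `n` linear forms on `ℝⁿ`. -/
noncomputable def rowDet (n : ℕ) :
    (EuclideanSpace ℝ (Fin n) →L[ℝ] ℝ) [⋀^Fin n]→ₗ[ℝ] ℝ :=
  (Matrix.detRowAlternating (n := Fin n) (R := ℝ)).compLinearMap
    { toFun := fun A k => A (EuclideanSpace.single k 1)
      map_add' := fun _ _ => rfl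
      map_smul' := fun _ _ => rfl }

lemma rowDet_apply (A : Fin n → 𝔼 →L[ℝ] ℝ) :
    rowDet n A = ∑ σ : Equiv.Perm (Fin n), ((Equiv.Perm.sign σ : ℤ) : ℝ) *
      ∏ j, A j (EuclideanSpace.single (σ j) 1) := by
  have : rowDet n A = Matrix.det (Matrix.of fun j k => A j (EuclideanSpace.single k 1)) := rfl
  rw [this, ← Matrix.det_transpose, Matrix.det_apply']
  rfl

lemma rowDet_proj_comp (A : 𝔼 →L[ℝ] 𝔼) :
    rowDet n (fun j => (EuclideanSpace.proj j : 𝔼 →L[ℝ] ℝ).comp A) = A.det := by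
  have h : rowDet n (fun j => (EuclideanSpace.proj j : 𝔼 →L[ℝ] ℝ).comp A) = Matrix.det
      (Matrix.of fun j k => A (EuclideanSpace.single k 1) j) := rfl
  rw [h, ContinuousLinearMap.det, ← LinearMap.det_toMatrix (EuclideanSpace.basisFun (Fin n) ℝ).toBasis]
  congr 1

lemma abs_rowDet_le (A : Fin n → 𝔼 →L[ℝ] ℝ) : |rowDet n A| ≤ n.factorial * ∏ j, ‖A j‖ := by
  rw [rowDet_apply]
  refine (Finset.abs_sum_le_sum_abs _ _).trans ?_
  have : ∀ σ ∈ (Finset.univ : Finset (Equiv.Perm (Fin n))), |((Equiv.Perm.sign σ : ℤ) : ℝ) *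
      ∏ j, A j (EuclideanSpace.single (σ j) 1)| ≤ ∏ j, ‖A j‖ := by
    intro σ _
    rw [abs_mul, Finset.abs_prod]
    have h1 : |((Equiv.Perm.sign σ : ℤ) : ℝ)| = 1 := by
      rcases Int.units_eq_one_or (Equiv.Perm.sign σ) with h | h <;> simp [h]
    rw [h1, one_mul]
    refine Finset.prod_le_prod (fun _ _ => abs_nonneg _) fun j _ => ?_
    have := (A j).le_opNorm (EuclideanSpace.single (σ j) 1)
    simpa using this
  refine (Finset.sum_le_sum this).trans (le_of_eq ?_)
  simp [Fintype.card_perm]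

lemma update_apply_eq {Y : Type*} (W : Fin n → Y → 𝔼 →L[ℝ] ℝ) (i : Fin n) (w : Y → 𝔼 →L[ℝ] ℝ) (x : Y) :
    (fun j => Function.update W i w j x) = Function.update (fun j => W j x) i (w x) := by
  ext j : 1
  by_cases h : j = i
  · subst h; simp
  · simp [h]

/-! ### Integrals of Jacobians with rows in `Lⁿ`. -/

section Integral

variable {X : Type*} [MeasurableSpace X] {μ : Measure X}
  {W : Fin n → X → EuclideanSpace ℝ (Fin n) →L[ℝ] ℝ}

lemma aestronglyMeasurable_rowDet (hW : ∀ j, AEStronglyMeasurable (W j) μ) :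
    AEStronglyMeasurable (fun x => rowDet n fun j => W j x) μ := by
  simp only [rowDet_apply]
  refine Finset.aestronglyMeasurable_fun_sum _ fun σ _ => ?_
  refine AEStronglyMeasurable.const_mul ?_ _
  refine Finset.aestronglyMeasurable_fun_prod _ fun j _ => ?_
  exact (hW j).apply_continuousLinearMap _

/-- Hölder's inequality with `n` factors of weight `1 / n` each. It makes the integral of the
determinant continuous in each row for the `Lⁿ` norm. -/
lemma lintegral_enorm_rowDet_le (hn : n ≠ 0) (hW : ∀ j, AEStronglyMeasurable (W j) μ) :
    ∫⁻ x, ‖rowDet n fun j => W j x‖ₑ ∂μ ≤ n.factorial * ∏ j, eLpNorm (W j) n μ := by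
  have hn' : (n : ℝ) ≠ 0 := by exact_mod_cast hn
  calc ∫⁻ x, ‖rowDet n fun j => W j x‖ₑ ∂μ
      ≤ ∫⁻ x, n.factorial * ∏ j, (‖W j x‖ₑ ^ (n : ℝ)) ^ (1 / (n : ℝ)) ∂μ := by
        refine lintegral_mono fun x => ?_
        have h := abs_rowDet_le fun j => W j x
        have e : ∀ j, (‖W j x‖ₑ ^ (n : ℝ)) ^ (1 / (n : ℝ)) = ‖W j x‖ₑ := fun j => by
          rw [← ENNReal.rpow_mul, mul_one_div_cancel hn', ENNReal.rpow_one]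
        simp only [e]
        rw [← ofReal_norm, Real.norm_eq_abs]
        refine (ENNReal.ofReal_le_ofReal h).trans (le_of_eq ?_)
        rw [ENNReal.ofReal_mul (by positivity), ENNReal.ofReal_natCast,
          ENNReal.ofReal_prod_of_nonneg fun _ _ => norm_nonneg _]
        simp
    _ = n.factorial * ∫⁻ x, ∏ j, (‖W j x‖ₑ ^ (n : ℝ)) ^ (1 / (n : ℝ)) ∂μ :=
        lintegral_const_mul' _ _ (by finiteness)
    _ ≤ n.factorial * ∏ j, (∫⁻ x, ‖W j x‖ₑ ^ (n : ℝ) ∂μ) ^ (1 / (n : ℝ)) := by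
        gcongr
        refine ENNReal.lintegral_prod_norm_pow_le _ (fun j _ => (hW j).enorm.pow_const _) ?_
          fun _ _ => by positivity
        simp [hn']
    _ = _ := by
        congr 1
        refine Finset.prod_congr rfl fun j _ => ?_
        rw [eLpNorm_eq_lintegral_rpow_enorm_toReal (by exact_mod_cast hn) (by simp)]
        simp

lemma integrable_rowDet (hn : n ≠ 0) (hW : ∀ j, MemLp (W j) n μ) :
    Integrable (fun x => rowDet n fun j => W j x) μ := by
  refine ⟨aestronglyMeasurable_rowDet fun j => (hW j).1, ?_⟩
  refine (lintegral_enorm_rowDet_le hn fun j => (hW j).1).trans_lt ?_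
  exact ENNReal.mul_lt_top (by finiteness) (ENNReal.prod_lt_top fun j _ => (hW j).2)

lemma memLp_update {s : ℝ≥0∞} {i : Fin n} {w : X → 𝔼 →L[ℝ] ℝ}
    (hW : ∀ j, j ≠ i → MemLp (W j) s μ) (hw : MemLp w s μ) (j : Fin n) :
    MemLp (Function.update W i w j) s μ := by
  by_cases h : j = i
  · subst h; simpa using hw
  · simpa [h] using hW j h

/-- The vanishing of the integral of a Jacobian is stable under convergence of one row in `Lⁿ`. -/
lemma integral_rowDet_update_eq_zero_of_tendsto (hn : n ≠ 0) {i : Fin n}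
    (hW : ∀ j, j ≠ i → MemLp (W j) n μ) {w : ℕ → X → 𝔼 →L[ℝ] ℝ} {w' : X → 𝔼 →L[ℝ] ℝ}
    (hw : ∀ k, MemLp (w k) n μ) (hw' : MemLp w' n μ)
    (h : Tendsto (fun k => eLpNorm (w k - w') n μ) atTop (𝓝 0))
    (h0 : ∀ k, ∫ x, rowDet n (fun j => Function.update W i (w k) j x) ∂μ = 0) :
    ∫ x, rowDet n (fun j => Function.update W i w' j x) ∂μ = 0 := by
  set P : ℝ≥0∞ := n.factorial * ∏ j ∈ Finset.univ.erase i, eLpNorm (W j) n μ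
  have hP : P ≠ ⊤ := ENNReal.mul_ne_top (by finiteness)
    (ENNReal.prod_ne_top fun j hj => (hW j (Finset.ne_of_mem_erase hj)).2.ne)
  have hbound : ∀ k, ‖∫ x, rowDet n (fun j => Function.update W i w' j x) ∂μ‖ₑ
      ≤ P * eLpNorm (w k - w') n μ := by
    intro k
    have hi1 := integrable_rowDet hn (memLp_update hW (hw k))
    have hi2 := integrable_rowDet hn (memLp_update hW hw')
    -- By linearity in row `i`, the change of the integral is the integral of the determinant with
    -- row `i` equal to `w k - w'`, which Hölder's inequality controls.
    have e : -∫ x, rowDet n (fun j => Function.update W i w' j x) ∂μ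
        = ∫ x, rowDet n (fun j => Function.update W i (w k - w') j x) ∂μ := by
      rw [← zero_sub, ← h0 k, ← integral_sub hi1 hi2]
      refine integral_congr_ae (.of_forall fun x => ?_)
      simp only [update_apply_eq, Pi.sub_apply]
      exact ((rowDet n).map_update_sub _ _ _ _).symm
    rw [← enorm_neg, e]
    refine (enorm_integral_le_lintegral_enorm _).trans ?_
    refine (lintegral_enorm_rowDet_le hn fun j =>
      (memLp_update hW ((hw k).sub hw') j).1).trans (le_of_eq ?_)
    rw [← Finset.mul_prod_erase _ _ (Finset.mem_univ i), Function.update_self]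
    have : ∏ j ∈ Finset.univ.erase i, eLpNorm (Function.update W i (w k - w') j) n μ
        = ∏ j ∈ Finset.univ.erase i, eLpNorm (W j) n μ :=
      Finset.prod_congr rfl fun j hj => by
        rw [Function.update_of_ne (Finset.ne_of_mem_erase hj)]
    rw [this]
    ring
  have hlim : Tendsto (fun k => P * eLpNorm (w k - w') n μ) atTop (𝓝 0) := by
    simpa using ENNReal.Tendsto.const_mul h (Or.inr hP)
  have := ge_of_tendsto' hlim hbound
  simpa using this

end Integral

lemma fderiv_fderiv_apply_comm {u : 𝔼 → ℝ} (hu : ContDiff ℝ ∞ u) (x v w : 𝔼) :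
    fderiv ℝ (fun y => fderiv ℝ u y v) x w = fderiv ℝ (fun y => fderiv ℝ u y w) x v := by
  have hd : Differentiable ℝ (fderiv ℝ u) :=
    (hu.fderiv_right (m := ∞) (by simp)).differentiable (by simp)
  have h : ∀ v w : 𝔼, fderiv ℝ (fun y => fderiv ℝ u y v) x w = fderiv ℝ (fderiv ℝ u) x w v := by
    intro v w
    have := ((hd x).hasFDerivAt.clm_apply (hasFDerivAt_const v x)).fderiv
    rw [this]
    simp
  rw [h, h]
  have hs := (((contDiff_infty.1 hu) 2).contDiffAt (x := x)).isSymmSndFDerivAt (by simp)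
  exact hs w v

/-- Null Lagrangian identity for smooth functions. -/
lemma integral_rowDet_fderiv_eq_zero {g : Fin n → 𝔼 → ℝ} (hg : ∀ j, ContDiff ℝ ∞ (g j)) (i : Fin n)
    (hi : HasCompactSupport (g i)) :
    ∫ x, rowDet n (fun j => fderiv ℝ (g j) x) = 0 := by
  have hη : IsTestFunction univ (g i) := ⟨hg i, hi, subset_univ _⟩
  set e : Fin n → 𝔼 := fun k => EuclideanSpace.single k 1
  set d : Equiv.Perm (Fin n) → Fin n → 𝔼 → ℝ := fun σ j x => fderiv ℝ (g j) x (e (σ j))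
  have hd : ∀ σ j, ContDiff ℝ ∞ (d σ j) := fun σ j =>
    ((hg j).fderiv_right (m := ∞) (by simp)).clm_apply contDiff_const
  set h : Equiv.Perm (Fin n) → 𝔼 → ℝ := fun σ x => ∏ j ∈ Finset.univ.erase i, d σ j x
  have hh : ∀ σ, ContDiff ℝ ∞ (h σ) := fun σ => contDiff_prod fun j _ => hd σ j
  have hsplit : ∀ x, rowDet n (fun j => fderiv ℝ (g j) x) = ∑ σ : Equiv.Perm (Fin n),
      ((Equiv.Perm.sign σ : ℤ) : ℝ) * (fderiv ℝ (g i) x (e (σ i)) • h σ x) := by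
    intro x
    rw [rowDet_apply]
    refine Finset.sum_congr rfl fun σ _ => ?_
    rw [← Finset.mul_prod_erase _ _ (Finset.mem_univ i)]
    rfl
  have hint : ∀ σ : Equiv.Perm (Fin n), Integrable fun x => fderiv ℝ (g i) x (e (σ i)) • h σ x :=
    fun σ => (hη.fderiv_apply _).integrable_smul
      ((hh σ).continuous.locallyIntegrable.locallyIntegrableOn _)
  have hint' : ∀ σ : Equiv.Perm (Fin n), Integrable fun x =>
      g i x • fderiv ℝ (h σ) x (e (σ i)) := fun σ =>
    hη.integrable_smul ((((hh σ).continuous_fderiv (by simp)).clm_apply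
      continuous_const).locallyIntegrable.locallyIntegrableOn _)
  simp only [hsplit]
  rw [integral_finsetSum _ fun σ _ => (hint σ).const_mul _]
  -- Integration by parts moves the derivative from the compactly supported `g i` to the product of
  -- the other rows; what remains is the divergence of a row of cofactors.
  have hparts : ∀ σ : Equiv.Perm (Fin n), ∫ x, ((Equiv.Perm.sign σ : ℤ) : ℝ) *
      (fderiv ℝ (g i) x (e (σ i)) • h σ x)
      = -∫ x, ((Equiv.Perm.sign σ : ℤ) : ℝ) * (g i x • fderiv ℝ (h σ) x (e (σ i))) := by
    intro σ
    rw [integral_const_mul, integral_const_mul,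
      (HasWeakFDeriv.of_contDiff (U := univ) (hh σ)).integral_eq hη, mul_neg]
  simp only [hparts]
  rw [Finset.sum_neg_distrib, ← integral_finsetSum _ fun σ _ => (hint' σ).const_mul _, neg_eq_zero]
  refine integral_eq_zero_of_ae (.of_forall fun x => ?_)
  simp only [Pi.zero_apply, smul_eq_mul]
  have hderiv : ∀ σ : Equiv.Perm (Fin n), fderiv ℝ (h σ) x (e (σ i)) =
      ∑ j ∈ Finset.univ.erase i, (∏ l ∈ (Finset.univ.erase i).erase j, d σ l x) *
        fderiv ℝ (d σ j) x (e (σ i)) := by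
    intro σ
    have := HasFDerivAt.finsetProd (u := Finset.univ.erase i) (g := d σ) (x := x)
      (fun j _ => ((hd σ j).differentiable (by simp) x).hasFDerivAt)
    rw [this.fderiv]
    simp
  simp only [hderiv, Finset.mul_sum]
  rw [Finset.sum_comm]
  refine Finset.sum_eq_zero fun j hj => ?_
  have hji : j ≠ i := Finset.ne_of_mem_erase hj
  -- For fixed `j ≠ i`, composing `σ` with the transposition of `i` and `j` swaps the two directions
  -- in which `g j` is differentiated and keeps the other factors. Second derivatives are symmetric
  -- and the sign flips, so the terms cancel in pairs.
  refine Finset.sum_involution (fun σ _ => σ * Equiv.swap i j) (fun σ _ => ?_) (fun σ _ _ => ?_)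
    (fun _ _ => Finset.mem_univ _) (fun σ _ => ?_)
  · have h1 : fderiv ℝ (d (σ * Equiv.swap i j) j) x (e ((σ * Equiv.swap i j) i))
        = fderiv ℝ (d σ j) x (e (σ i)) := by
      simp only [d, Equiv.Perm.mul_apply, Equiv.swap_apply_left, Equiv.swap_apply_right]
      exact fderiv_fderiv_apply_comm (hg j) x _ _
    have h2 : ∏ l ∈ (Finset.univ.erase i).erase j, d (σ * Equiv.swap i j) l x
        = ∏ l ∈ (Finset.univ.erase i).erase j, d σ l x := by
      refine Finset.prod_congr rfl fun l hl => ?_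
      have hlj : l ≠ j := Finset.ne_of_mem_erase hl
      have hli : l ≠ i := Finset.ne_of_mem_erase (Finset.mem_of_mem_erase hl)
      simp only [d, Equiv.Perm.mul_apply, Equiv.swap_apply_of_ne_of_ne hli hlj]
    rw [h1, h2, Equiv.Perm.sign_mul, Equiv.Perm.sign_swap hji.symm]
    push_cast
    ring
  · intro hσ
    have := mul_eq_left.1 hσ
    exact hji (Equiv.swap_eq_one_iff.1 this).symm
  · rw [mul_assoc, Equiv.swap_mul_self, mul_one]

/-- Null Lagrangian identity for weak gradients in `Lⁿ(ℝⁿ)`. -/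
lemma integral_rowDet_eq_zero_of_univ (hn : n ≠ 0) {i : Fin n} {η : 𝔼 → ℝ}
    (hη : IsTestFunction univ η) (s : Finset (Fin n)) :
    ∀ W : Fin n → 𝔼 → 𝔼 →L[ℝ] ℝ, W i = fderiv ℝ η → (∀ j, MemLp (W j) n volume) →
      (∀ j, ∃ g, HasWeakFDeriv univ g (W j)) →
      (∀ j ∉ s, ∃ g, ContDiff ℝ ∞ g ∧ W j = fderiv ℝ g) →
      ∫ x, rowDet n (fun j => W j x) = 0 := by
  have hn1 : (1 : ℝ≥0∞) ≤ n := by exact_mod_cast Nat.one_le_iff_ne_zero.2 hn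
  -- The set `s` contains the rows not yet known to be gradients of smooth functions. Each induction
  -- step mollifies one of them and passes to the limit; row `i` is never touched.
  induction s using Finset.induction_on with
  | empty =>
    intro W hWi _ _ hW
    have hW' : ∀ j, ∃ g, ContDiff ℝ ∞ g ∧ W j = fderiv ℝ g ∧ (j = i → g = η) := by
      intro j
      by_cases hj : j = i
      · subst hj
        exact ⟨η, hη.1, hWi, fun _ => rfl⟩
      · obtain ⟨g, h1, h2⟩ := hW j (Finset.notMem_empty j)
        exact ⟨g, h1, h2, fun h => absurd h hj⟩
    choose g hg hWg hgi using hW'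
    simp only [hWg]
    exact integral_rowDet_fderiv_eq_zero hg i (by rw [hgi i rfl]; exact hη.2.1)
  | insert a s has ih =>
    intro W hWi hWL hWD hW
    by_cases hai : a = i
    · refine ih W hWi hWL hWD fun j hj => ?_
      by_cases hja : j = a
      · subst hja
        exact ⟨η, hη.1, by rw [hai, hWi]⟩
      · exact hW j (by simp [hja, hj])
    · obtain ⟨g, hg⟩ := hWD a
      have hgl : LocallyIntegrable g := locallyIntegrableOn_univ.1 hg.1
      have hml : ∀ k, MemLp (mollify (bumpSeq n k) (W a)) n volume := fun k => by
        refine ⟨?_, (eLpNorm_mollify_le _ hn1 (by simp) (hWL a).1).trans_lt (hWL a).2⟩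
        exact (contDiff_mollify _ ((hWL a).locallyIntegrable hn1)).continuous.aestronglyMeasurable
      have key := integral_rowDet_update_eq_zero_of_tendsto hn (W := W) (i := a)
        (fun j _ => hWL j) hml (hWL a) (tendsto_eLpNorm_mollify_bumpSeq_sub hn1 (by simp) (hWL a))
        fun k => ?_
      · simpa using key
      · have hs := contDiff_mollify (bumpSeq n k) hgl
        refine ih _ ?_ (memLp_update (fun j _ => hWL j) (hml k)) (fun j => ?_) fun j hj => ?_
        · rw [Function.update_of_ne (Ne.symm hai), hWi]
        · by_cases hja : j = a
          · subst hja
            refine ⟨mollify (bumpSeq n k) g, ?_⟩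
            rw [Function.update_self, ← fderiv_mollify hg]
            exact .of_contDiff hs
          · simpa [hja] using hWD j
        · by_cases hja : j = a
          · subst hja
            exact ⟨mollify (bumpSeq n k) g, hs, by rw [Function.update_self, fderiv_mollify hg]⟩
          · rw [Function.update_of_ne hja]
            exact hW j (by simp [hja, hj])

/-- Null Lagrangian identity for functions in `W^{1,n}_loc`. -/
lemma integral_rowDet_update_fderiv_eq_zero (hn : n ≠ 0) {U : Set 𝔼} (hU : IsOpen U)
    {u : Fin n → 𝔼 → ℝ} {Du : Fin n → 𝔼 → 𝔼 →L[ℝ] ℝ}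
    (h : ∀ j, HasSobolevLocDeriv U n (u j) (Du j)) {η : 𝔼 → ℝ} (hη : IsTestFunction U η)
    (i : Fin n) :
    ∫ x in U, rowDet n (fun j => Function.update Du i (fderiv ℝ η) j x) = 0 := by
  have hzero : ∀ W : Fin n → 𝔼 → 𝔼 →L[ℝ] ℝ, ∀ x, fderiv ℝ η x = 0 →
      rowDet n (fun j => Function.update W i (fderiv ℝ η) j x) = 0 := by
    intro W x hx
    rw [update_apply_eq, hx]
    exact (rowDet n).map_update_zero _ _
  rw [setIntegral_eq_integral_of_forall_compl_eq_zero
    fun x hx => hzero Du x (hη.fderiv_eq_zero_of_notMem hx)]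
  -- Only the other rows near the support of `η` matter. Cutting off the functions there yields
  -- gradients in `Lⁿ` of the whole space without changing the integrand.
  obtain ⟨χ, V, hχ, hV, hKV, hVU, h1⟩ := exists_isTestFunction_eq_one hU hη.2.1.isCompact hη.2.2
  set W : Fin n → 𝔼 → 𝔼 →L[ℝ] ℝ := fun j x => χ x • Du j x + u j x • fderiv ℝ χ x
  have hηL : MemLp (fderiv ℝ η) n volume :=
    hη.continuous_fderiv.memLp_of_hasCompactSupport (hη.2.1.fderiv ℝ)
  have hW : ∀ j, MemLp (W j) n volume := by
    intro j
    obtain ⟨hu, hDu⟩ := (h j).2 (tsupport χ) hχ.2.1.isCompact hχ.2.2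
    obtain ⟨c1, hc1⟩ := hχ.exists_bound
    obtain ⟨c2, hc2⟩ := (hχ.2.1.fderiv ℝ).exists_bound_of_continuous hχ.continuous_fderiv
    have m1 : MemLp (fun x => χ x • Du j x) n (volume.restrict (tsupport χ)) :=
      hDu.of_le_mul (c := c1) (hχ.1.continuous.aestronglyMeasurable.smul hDu.1)
        (.of_forall fun x => by rw [norm_smul]; gcongr; exact hc1 x)
    have m2 : MemLp (fun x => u j x • fderiv ℝ χ x) n (volume.restrict (tsupport χ)) :=
      hu.of_le_mul (c := c2) (hu.1.smul hχ.continuous_fderiv.aestronglyMeasurable)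
        (.of_forall fun x => by rw [norm_smul, mul_comm]; gcongr; exact hc2 x)
    have m3 : MemLp (W j) n (volume.restrict (tsupport χ)) := by
      have := MemLp.add (ε := 𝔼 →L[ℝ] ℝ) m1 m2
      exact this
    have hind : (tsupport χ).indicator (W j) = W j := by
      refine indicator_eq_self.2 fun x hx => ?_
      by_contra h0
      exact hx (by simp [W, image_eq_zero_of_notMem_tsupport h0, fderiv_of_notMem_tsupport ℝ h0])
    rw [← hind]
    refine (memLp_indicator_iff_restrict (ε := 𝔼 →L[ℝ] ℝ) (isClosed_tsupport χ).measurableSet).2 ?_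
    exact m3
  have hmain := integral_rowDet_eq_zero_of_univ hn (hη.mono (subset_univ U)) (i := i) Finset.univ
    (Function.update W i (fderiv ℝ η)) (Function.update_self ..)
    (memLp_update (fun j _ => hW j) hηL) (fun j => ?_) (fun j hj => absurd (Finset.mem_univ j) hj)
  · rw [← hmain]
    refine integral_congr_ae (.of_forall fun x => ?_)
    by_cases hx : x ∈ tsupport η
    · have hxV := hKV hx
      have h0 : fderiv ℝ χ x = 0 := by
        have : χ =ᶠ[𝓝 x] fun _ => 1 := by
          filter_upwards [hV.mem_nhds hxV] with y hy using h1 y hy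
        rw [this.fderiv_eq]
        simp
      simp only [update_apply_eq]
      congr 2
      ext j : 1
      simp [W, h1 x hxV, h0]
    · dsimp only
      rw [hzero _ _ (fderiv_of_notMem_tsupport ℝ hx), hzero _ _ (fderiv_of_notMem_tsupport ℝ hx)]
  · by_cases hj : j = i
    · subst hj
      exact ⟨η, by rw [Function.update_self]; exact .of_contDiff hη.1⟩
    · rw [Function.update_of_ne hj]
      exact ⟨_, (h j).1.cutoff hχ⟩

/-! ### Level set estimates -/

/-- Stampacchia's iteration lemma. -/
lemma eq_zero_of_level_decay {A : ℝ → ℝ≥0∞} (hA : Antitone A) (hA0 : A 0 ≠ ⊤) {c : ℝ≥0∞} {δ : ℝ}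
    (hδ : 0 < δ)
    (h : ∀ t s : ℝ, 0 ≤ t → t < s → ENNReal.ofReal (s - t) * A s ≤ c * A t ^ (1 + δ)) {d : ℝ}
    (hd : 0 < d) (hcd : c * A 0 ^ δ ≤ ENNReal.ofReal d * (2⁻¹ * 2 ^ (-(1 / δ)))) : A d = 0 := by
  -- The ratio `r` satisfies `r ^ δ = 1/2`. Along the levels `d (1 - 2^{-k})` the gaps halve, and
  -- the factor `(r ^ k) ^ δ = 2^{-k}` gained from the superlinear exponent compensates exactly. In
  -- `hcd`, the factor `2⁻¹` pays for the first gap and `r` for one step of decay.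
  set r : ℝ≥0∞ := 2 ^ (-(1 / δ))
  have hrδ : r ^ δ = 2⁻¹ := by
    simp only [r]
    rw [← ENNReal.rpow_mul, neg_mul, one_div_mul_cancel hδ.ne', ENNReal.rpow_neg_one]
  have hr1 : r < 1 := by
    apply ENNReal.rpow_lt_one_of_one_lt_of_neg (by norm_num)
    have : 0 < 1 / δ := by positivity
    linarith
  clear_value r
  have hrk : ∀ k : ℕ, (r ^ k) ^ δ = 2⁻¹ ^ k := fun k => by
    rw [← ENNReal.rpow_natCast r k, ← ENNReal.rpow_mul, mul_comm (k : ℝ) δ, ENNReal.rpow_mul r δ,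
      hrδ, ENNReal.rpow_natCast]
  have hstep : ∀ k : ℕ, A (d * (1 - (1 / 2) ^ k)) ≤ A 0 * r ^ k := by
    intro k
    induction k with
    | zero => simp
    | succ k ih =>
      set t := d * (1 - (1 / 2 : ℝ) ^ k)
      set s := d * (1 - (1 / 2 : ℝ) ^ (k + 1))
      have hst : s - t = d * (1 / 2) ^ (k + 1) := by simp only [s, t]; ring
      have ht0 : 0 ≤ t := mul_nonneg hd.le (sub_nonneg.2 (pow_le_one₀ (by norm_num) (by norm_num)))
      have hpos : 0 < d * (1 / 2 : ℝ) ^ (k + 1) := by positivity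
      have h1 := h t s ht0 (by linarith)
      rw [hst] at h1
      have e : ENNReal.ofReal (d * (1 / 2) ^ (k + 1)) = ENNReal.ofReal d * 2⁻¹ ^ (k + 1) := by
        rw [ENNReal.ofReal_mul hd.le, ENNReal.ofReal_pow (by norm_num), one_div,
          ENNReal.ofReal_inv_of_pos (by norm_num)]
        simp
      have h2 : ENNReal.ofReal (d * (1 / 2) ^ (k + 1)) * A s
          ≤ ENNReal.ofReal (d * (1 / 2) ^ (k + 1)) * (A 0 * r ^ (k + 1)) := by
        calc _ ≤ c * A t ^ (1 + δ) := h1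
          _ ≤ c * (A 0 * r ^ k) ^ (1 + δ) := by gcongr
          _ = (c * A 0 ^ δ) * (A 0 * r ^ k * 2⁻¹ ^ k) := by
              rw [ENNReal.rpow_add_of_nonneg _ _ zero_le_one hδ.le, ENNReal.rpow_one,
                ENNReal.mul_rpow_of_nonneg _ _ hδ.le, hrk]
              ring
          _ ≤ (ENNReal.ofReal d * (2⁻¹ * r)) * (A 0 * r ^ k * 2⁻¹ ^ k) := by gcongr
          _ = _ := by rw [e]; ring
      exact (ENNReal.mul_le_mul_iff_right (ENNReal.ofReal_pos.2 hpos).ne' ENNReal.ofReal_ne_top).1 h2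
  have hle : ∀ k : ℕ, A d ≤ A 0 * r ^ k := fun k => by
    refine (hA ?_).trans (hstep k)
    have : (0 : ℝ) ≤ (1 / 2) ^ k := by positivity
    nlinarith
  have hlim : Tendsto (fun k : ℕ => A 0 * r ^ k) atTop (𝓝 0) := by
    simpa using ENNReal.Tendsto.const_mul (ENNReal.tendsto_pow_atTop_nhds_zero_of_lt_one hr1)
      (Or.inr hA0)
  simpa using ge_of_tendsto' hlim hle

/-- A smooth approximation of `s ↦ (s - t)⁺`. -/
lemma exists_smooth_posPart (t : ℝ) {ε : ℝ} (hε : 0 < ε) :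
    ∃ G : ℝ → ℝ, ContDiff ℝ ∞ G ∧ (∀ s, 0 ≤ deriv G s) ∧ (∀ s, deriv G s ≤ 1) ∧
      (∀ s ≤ t, G s = 0) ∧ (∀ s ≤ t, deriv G s = 0) ∧ ∀ s, s - t - ε ≤ G s := by
  -- The derivative of `G`: a smooth step from 0 at `t` to 1 at `t + ε`. Integrating it loses at
  -- most `ε` against `(s - t)⁺`.
  set g : ℝ → ℝ := fun s => Real.smoothTransition ((s - t) / ε)
  have hg : ContDiff ℝ ∞ g :=
    Real.smoothTransition.contDiff.comp ((contDiff_id.sub contDiff_const).div_const ε)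
  have hg0 : ∀ s ≤ t, g s = 0 := fun s hs =>
    Real.smoothTransition.zero_of_nonpos (div_nonpos_of_nonpos_of_nonneg (by linarith) hε.le)
  have hint : ∀ a b, IntervalIntegrable g volume a b := fun a b =>
    hg.continuous.intervalIntegrable a b
  have hnn : ∀ s, 0 ≤ g s := fun s => Real.smoothTransition.nonneg _
  set G : ℝ → ℝ := fun s => ∫ r in t..s, g r
  have hd : ∀ s, HasDerivAt G (g s) s := fun s =>
    intervalIntegral.integral_hasDerivAt_right (hint t s)
      hg.continuous.stronglyMeasurable.stronglyMeasurableAtFilter hg.continuous.continuousAt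
  have hdG : deriv G = g := funext fun s => (hd s).deriv
  have hGnn : ∀ s, 0 ≤ G s := fun s => by
    rcases le_total t s with h | h
    · exact intervalIntegral.integral_nonneg h fun r _ => hnn r
    · simp only [G]
      rw [intervalIntegral.integral_symm, intervalIntegral.integral_congr (g := fun _ => 0)]
      · simp
      · intro r hr
        rw [uIcc_of_le h] at hr
        exact hg0 r hr.2
  refine ⟨G, contDiff_infty_iff_deriv.2 ⟨fun s => (hd s).differentiableAt, hdG ▸ hg⟩, ?_, ?_, ?_, ?_,
    fun s => ?_⟩
  · rw [hdG]; exact hnn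
  · rw [hdG]; exact fun s => Real.smoothTransition.le_one _
  · intro s hs
    simp only [G]
    rw [intervalIntegral.integral_symm, intervalIntegral.integral_congr (g := fun _ => 0)]
    · simp
    · intro r hr
      rw [uIcc_of_le hs] at hr
      exact hg0 r hr.2
  · rw [hdG]; exact hg0
  · rcases le_total s (t + ε) with h | h
    · exact le_trans (by linarith) (hGnn s)
    · have e : G s = G (t + ε) + ∫ r in (t + ε)..s, g r :=
        (intervalIntegral.integral_add_adjacent_intervals (hint _ _) (hint _ _)).symm
      have e2 : ∫ r in (t + ε)..s, g r = ∫ r in (t + ε)..s, (1 : ℝ) := by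
        refine intervalIntegral.integral_congr fun r hr => ?_
        rw [uIcc_of_le h] at hr
        exact Real.smoothTransition.one_of_one_le ((one_le_div hε).2 (by linarith [hr.1]))
      rw [e, e2]
      simp only [intervalIntegral.integral_const, smul_eq_mul, mul_one]
      linarith [hGnn (t + ε)]

/-- The Gagliardo–Nirenberg–Sobolev inequality for limits of test functions. -/
lemma eLpNorm_le_of_tendsto_isTestFunction {U : Set 𝔼} (hU : MeasurableSet U) {r : ℝ≥0}
    (hr : NNReal.HolderConjugate n r) {ζ : ℕ → 𝔼 → ℝ} {u : 𝔼 → ℝ} {w : 𝔼 → 𝔼 →L[ℝ] ℝ}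
    (hζ : ∀ k, IsTestFunction U (ζ k))
    (hw : AEStronglyMeasurable w (volume.restrict U))
    (h1 : Tendsto (fun k => eLpNorm (fderiv ℝ (ζ k) - w) 1 (volume.restrict U)) atTop (𝓝 0))
    (h2 : ∀ᵐ x ∂(volume.restrict U), Tendsto (fun k => ζ k x) atTop (𝓝 (u x))) :
    eLpNorm u r (volume.restrict U) ≤
      eLpNormLESNormFDerivOneConst (volume : Measure 𝔼) r * eLpNorm w 1 (volume.restrict U) := by
  set C : ℝ≥0∞ := ↑(eLpNormLESNormFDerivOneConst (volume : Measure 𝔼) r)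
  have hb : ∀ k, eLpNorm (ζ k) r (volume.restrict U) ≤
      C * (eLpNorm (fderiv ℝ (ζ k) - w) 1 (volume.restrict U) + eLpNorm w 1 (volume.restrict U)) := by
    intro k
    have hS := eLpNorm_le_eLpNorm_fderiv_one (volume : Measure 𝔼) ((hζ k).1.of_le (by simp))
      (hζ k).2.1 (p := r) (by simpa using hr)
    have hind : U.indicator (fderiv ℝ (ζ k)) = fderiv ℝ (ζ k) := by
      refine indicator_eq_self.2 fun x hx => ?_
      by_contra h0
      exact hx ((hζ k).fderiv_eq_zero_of_notMem h0)
    calc eLpNorm (ζ k) r (volume.restrict U) ≤ eLpNorm (ζ k) r volume :=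
          eLpNorm_mono_measure _ Measure.restrict_le_self
      _ ≤ C * eLpNorm (fderiv ℝ (ζ k)) 1 volume := hS
      _ = C * eLpNorm (fderiv ℝ (ζ k)) 1 (volume.restrict U) := by
          rw [← eLpNorm_indicator_eq_eLpNorm_restrict (ε := 𝔼 →L[ℝ] ℝ) (f := fderiv ℝ (ζ k)) hU,
            hind]
      _ ≤ _ := by
          gcongr
          have := eLpNorm_add_le (f := fderiv ℝ (ζ k) - w) (g := w) (μ := volume.restrict U)
            (((hζ k).continuous_fderiv.aestronglyMeasurable).sub hw) hw le_rfl
          simpa using this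
  have hlim : Tendsto (fun k => C * (eLpNorm (fderiv ℝ (ζ k) - w) 1 (volume.restrict U)
      + eLpNorm w 1 (volume.restrict U))) atTop (𝓝 (C * eLpNorm w 1 (volume.restrict U))) := by
    have := ENNReal.Tendsto.const_mul (a := C) (h1.add_const (eLpNorm w 1 (volume.restrict U)))
      (Or.inr ENNReal.coe_ne_top)
    simpa using this
  -- Fatou's lemma: almost everywhere convergence of the test functions is enough on the left side.
  refine (Lp.eLpNorm_lim_le_liminf_eLpNorm
    (fun k => (hζ k).1.continuous.aestronglyMeasurable) u h2).trans ?_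
  rw [← hlim.liminf_eq]
  exact liminf_le_liminf (.of_forall hb)

/-- Hölder estimate for a gradient `D` weighted by `θ`, from a weighted energy bound. -/
lemma lintegral_mul_le_of_energy_le {X : Type*} [MeasurableSpace X] {μ : Measure X} (hn : 2 ≤ n)
    {p q : ℝ≥0∞} (hp : 1 ≤ p) (hq : 1 ≤ q) {K : X → ℝ} {T D θ : X → ℝ≥0∞} {A : Set X}
    (hK : AEMeasurable K μ) (hK1 : ∀ᵐ x ∂μ, 1 ≤ K x) (hT : AEMeasurable T μ)
    (hD : AEMeasurable D μ) (hθ : AEMeasurable θ μ) (hθ1 : ∀ x, θ x ≤ 1) (hθA : ∀ x ∉ A, θ x = 0)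
    (h : ∫⁻ x, θ x * (D x ^ n / ENNReal.ofReal (K x)) ∂μ ≤ ∫⁻ x, θ x * T x ∂μ) :
    ∫⁻ x, θ x * D x ∂μ ≤ (eLpNorm K p μ * eLpNorm T q μ) ^ (1 / (n : ℝ)) *
      μ A ^ (1 - (p⁻¹.toReal + q⁻¹.toReal) / n) := by
  have hn2 : (2 : ℝ) ≤ n := by exact_mod_cast hn
  have hn0 : (0 : ℝ) < n := by linarith
  have hn1 : (0 : ℝ) < n - 1 := by linarith
  have hrestr : ∀ g : X → ℝ≥0∞, ∫⁻ x, θ x * g x ∂μ = ∫⁻ x in A, θ x * g x ∂μ := fun g => by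
    rw [setLIntegral_eq_of_support_subset]
    intro x hx
    by_contra hxA
    exact hx (by simp [hθA x hxA])
  set ν := μ.restrict A
  have hνuniv : ν univ = μ A := by simp [ν]
  have hKν : AEMeasurable K ν := hK.restrict
  have hK1ν : ∀ᵐ x ∂ν, 1 ≤ K x := ae_restrict_of_ae hK1
  set a : X → ℝ≥0∞ := fun x => θ x * (D x ^ n / ENNReal.ofReal (K x))
  have ha : AEMeasurable a ν :=
    (hθ.restrict).mul ((hD.restrict.pow_const n).div hKν.ennreal_ofReal)
  have hconj : Real.HolderConjugate n (n / (n - 1)) :=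
    Real.HolderConjugate.conjExponent (by linarith)
  -- The weight is distributed as `θ D ≤ (θ Dⁿ / K)^{1/n} K^{1/n}`, using `θⁿ ≤ θ`.
  have hpt : ∀ᵐ x ∂ν, θ x * D x ≤ ((fun x => a x ^ (1 / (n : ℝ))) *
      fun x => ENNReal.ofReal (K x) ^ (1 / (n : ℝ))) x := by
    filter_upwards [hK1ν] with x hx
    have hk0 : ENNReal.ofReal (K x) ≠ 0 := (ENNReal.ofReal_pos.2 (by linarith)).ne'
    rw [Pi.mul_apply, ← ENNReal.mul_rpow_of_nonneg _ _ (by positivity)]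
    simp only [a]
    rw [mul_assoc, ENNReal.div_mul_cancel hk0 ENNReal.ofReal_ne_top]
    calc θ x * D x = ((θ x * D x) ^ n) ^ (1 / (n : ℝ)) := by
          rw [← ENNReal.rpow_natCast, ← ENNReal.rpow_mul, mul_one_div_cancel hn0.ne',
            ENNReal.rpow_one]
      _ ≤ _ := by
          gcongr
          rw [mul_pow]
          gcongr
          exact pow_le_of_le_one (zero_le) (hθ1 x) (by omega)
  have hHol := ENNReal.lintegral_mul_le_Lp_mul_Lq ν hconj (ha.pow_const (1 / (n : ℝ)))
    (hKν.ennreal_ofReal.pow_const (1 / (n : ℝ)))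
  have hinv : ∀ s : ℝ≥0∞, 1 ≤ s → s⁻¹.toReal ≤ 1 := fun s hs => by
    rw [← ENNReal.toReal_one]
    exact ENNReal.toReal_mono ENNReal.one_ne_top (ENNReal.inv_le_one.2 hs)
  have hE1 : ∫⁻ x, (a x ^ (1 / (n : ℝ))) ^ (n : ℝ) ∂ν ≤
      eLpNorm T q μ * μ A ^ (1 - q⁻¹.toReal) := by
    calc ∫⁻ x, (a x ^ (1 / (n : ℝ))) ^ (n : ℝ) ∂ν = ∫⁻ x, a x ∂ν := by
          refine lintegral_congr fun x => ?_
          rw [← ENNReal.rpow_mul, one_div_mul_cancel hn0.ne', ENNReal.rpow_one]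
      _ ≤ ∫⁻ x, θ x * T x ∂ν := by
          rw [← hrestr, ← hrestr] ; exact h
      _ ≤ ∫⁻ x, T x ∂ν := lintegral_mono fun x => mul_le_of_le_one_left zero_le (hθ1 x)
      _ = eLpNorm T 1 ν := by simp [eLpNorm_one_eq_lintegral_enorm]
      _ ≤ eLpNorm T q ν * ν univ ^ (1 / (1 : ℝ≥0∞).toReal - 1 / q.toReal) :=
          eLpNorm_le_eLpNorm_mul_rpow_measure_univ hq hT.restrict.aestronglyMeasurable
      _ ≤ _ := by
          rw [hνuniv, ENNReal.toReal_inv, ENNReal.toReal_one, div_one, one_div]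
          gcongr
          exact Measure.restrict_le_self
  have hE2 : (∫⁻ x, (ENNReal.ofReal (K x) ^ (1 / (n : ℝ))) ^ ((n : ℝ) / (n - 1)) ∂ν) ^
      (1 / ((n : ℝ) / (n - 1))) ≤
      (eLpNorm K p μ * μ A ^ ((n : ℝ) - 1 - p⁻¹.toReal)) ^ (1 / (n : ℝ)) := by
    -- The exponent conjugate to `n` leaves `K` with the power `1 / (n - 1)`. It is at most 1, hence
    -- at most `p`, so the comparison of norms on a set of measure `μ A` applies although this may
    -- not be a norm.
    set r : ℝ≥0∞ := ENNReal.ofReal (1 / ((n : ℝ) - 1))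
    have hr : r.toReal = 1 / ((n : ℝ) - 1) := ENNReal.toReal_ofReal (by positivity)
    have hr0 : r ≠ 0 := (ENNReal.ofReal_pos.2 (by positivity)).ne'
    have hr1 : r ≤ 1 := by
      rw [← ENNReal.ofReal_one]
      apply ENNReal.ofReal_le_ofReal
      rw [div_le_one hn1]
      linarith
    have e : ∫⁻ x, (ENNReal.ofReal (K x) ^ (1 / (n : ℝ))) ^ ((n : ℝ) / (n - 1)) ∂ν
        = ∫⁻ x, ‖K x‖ₑ ^ r.toReal ∂ν := by
      refine lintegral_congr_ae ?_
      filter_upwards [hK1ν] with x hx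
      rw [← ENNReal.rpow_mul, hr, Real.enorm_eq_ofReal (by linarith)]
      congr 1
      field_simp
    have e2 : (1 / ((n : ℝ) / (n - 1))) = (1 / r.toReal) * (1 / (n : ℝ)) := by
      rw [hr]
      field_simp
    rw [e, e2, ENNReal.rpow_mul, ← eLpNorm_eq_lintegral_rpow_enorm_toReal hr0 ENNReal.ofReal_ne_top]
    gcongr
    refine (eLpNorm_le_eLpNorm_mul_rpow_measure_univ (hr1.trans hp)
      hKν.aestronglyMeasurable).trans ?_
    rw [hνuniv, hr, one_div_one_div, one_div, ← ENNReal.toReal_inv]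
    gcongr
    exact Measure.restrict_le_self
  have hx1 : 0 ≤ 1 - q⁻¹.toReal := by linarith [hinv q hq]
  have hx2 : 0 ≤ (n : ℝ) - 1 - p⁻¹.toReal := by linarith [hinv p hp]
  calc ∫⁻ x, θ x * D x ∂μ = ∫⁻ x, θ x * D x ∂ν := hrestr D
    _ ≤ _ := lintegral_mono_ae hpt
    _ ≤ _ := hHol
    _ ≤ (eLpNorm T q μ * μ A ^ (1 - q⁻¹.toReal)) ^ (1 / (n : ℝ)) *
        (eLpNorm K p μ * μ A ^ ((n : ℝ) - 1 - p⁻¹.toReal)) ^ (1 / (n : ℝ)) := by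
        gcongr
    _ = _ := by
        rw [← ENNReal.mul_rpow_of_nonneg _ _ (by positivity), mul_mul_mul_comm,
          ← ENNReal.rpow_add_of_nonneg _ _ hx1 hx2, ENNReal.mul_rpow_of_nonneg _ _ (by positivity),
          ← ENNReal.rpow_mul, mul_comm (eLpNorm T q μ)]
        congr 2
        field_simp
        ring

/-! ### The supremum bound -/

/-- The coordinates of the derivative. -/
noncomputable def derivRow (Df : 𝔼 → 𝔼 →L[ℝ] 𝔼) (j : Fin n) (x : 𝔼) : 𝔼 →L[ℝ] ℝ :=
  (EuclideanSpace.proj j : 𝔼 →L[ℝ] ℝ).comp (Df x)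

lemma norm_derivRow_le (Df : 𝔼 → 𝔼 →L[ℝ] 𝔼) (j : Fin n) (x : 𝔼) : ‖derivRow Df j x‖ ≤ ‖Df x‖ :=
  ContinuousLinearMap.opNorm_le_bound _ (norm_nonneg _) fun v =>
    (PiLp.norm_apply_le (Df x v) j).trans ((Df x).le_opNorm v)

lemma memLp_derivRow {Df : 𝔼 → 𝔼 →L[ℝ] 𝔼} {s : ℝ≥0∞} {μ : Measure 𝔼} (h : MemLp Df s μ) (j : Fin n) :
    MemLp (derivRow Df j) s μ :=
  h.mono ((compL ℝ 𝔼 𝔼 ℝ (EuclideanSpace.proj j)).continuous.comp_aestronglyMeasurable h.1)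
    (.of_forall fun x => norm_derivRow_le Df j x)

lemma rowDet_derivRow (Df : 𝔼 → 𝔼 →L[ℝ] 𝔼) (x : 𝔼) :
    rowDet n (fun j => derivRow Df j x) = (Df x).det :=
  rowDet_proj_comp (Df x)

/-- The function `(σ y + b)⁺`. For `σ = ±1`, this covers both truncations. -/
noncomputable def signedPosPart (σ b y : ℝ) : ℝ := max (σ * y + b) 0

/-! ### The chain rule for truncated coordinates and the energy inequality. -/

section Truncation

variable {U : Set (EuclideanSpace ℝ (Fin n))}
  {f : EuclideanSpace ℝ (Fin n) → EuclideanSpace ℝ (Fin n)}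
  {Df : EuclideanSpace ℝ (Fin n) → EuclideanSpace ℝ (Fin n) →L[ℝ] EuclideanSpace ℝ (Fin n)}
  {i : Fin n} {σ b : ℝ} {Dφ : EuclideanSpace ℝ (Fin n) → EuclideanSpace ℝ (Fin n) →L[ℝ] ℝ}
  {G : ℝ → ℝ}

/-- Because `G` vanishes on `(-∞, 0]`, the corner of the positive part is invisible: `G ∘ φ = H ∘
f_i` with the smooth function `H y = G (σ y + b)`. The smooth chain rule computes its derivative in
two ways, and weak derivatives are unique. -/
lemma deriv_comp_truncation_ae_eq (hU : IsOpen U) (hσ : |σ| ≤ 1) (hf : HasWeakFDeriv U f Df)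
    (hφ : HasWeakFDeriv U (fun x => signedPosPart σ b (f x i)) Dφ) (hG : ContDiff ℝ ∞ G)
    (hL : ∀ t, |deriv G t| ≤ 1) (hG0 : ∀ t ≤ 0, G t = 0) (hG0' : ∀ t ≤ 0, deriv G t = 0) :
    ∀ᵐ x ∂(volume.restrict U), deriv G (signedPosPart σ b (f x i)) • Dφ x =
      (σ * deriv G (signedPosPart σ b (f x i))) • derivRow Df i x := by
  set H : ℝ → ℝ := fun y => G (σ * y + b)
  have hH : ContDiff ℝ ∞ H := hG.comp ((contDiff_const.mul contDiff_id).add contDiff_const)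
  have hmax : ∀ y, G (signedPosPart σ b y) = H y := fun y => by
    simp only [signedPosPart, H]
    rcases le_total (σ * y + b) 0 with h | h
    · rw [max_eq_right h, hG0 _ h, hG0 0 le_rfl]
    · rw [max_eq_left h]
  have hmax' : ∀ y, deriv G (signedPosPart σ b y) = deriv G (σ * y + b) := fun y => by
    simp only [signedPosPart]
    rcases le_total (σ * y + b) 0 with h | h
    · rw [max_eq_right h, hG0' _ h, hG0' 0 le_rfl]
    · rw [max_eq_left h]
  have hH' : ∀ y, deriv H y = σ * deriv G (σ * y + b) := fun y => by
    have h1 : HasDerivAt (fun y => σ * y + b) (σ * 1) y :=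
      ((hasDerivAt_id y).const_mul σ).add_const b
    have h2 := (hG.differentiable (by simp) (σ * y + b)).hasDerivAt.comp y h1
    have h3 : HasDerivAt H _ y := h2
    rw [h3.deriv]
    ring
  have hLH : ∀ t, |deriv H t| ≤ 1 := fun t => by
    rw [hH', abs_mul]
    exact mul_le_one₀ hσ (abs_nonneg _) (hL _)
  have c1 := hφ.comp hU hG hL
  have c2 := (hf.clm_comp (EuclideanSpace.proj i : 𝔼 →L[ℝ] ℝ)).comp hU hH hLH
  have e : (fun x => G (signedPosPart σ b (f x i))) = fun x => H ((EuclideanSpace.proj i :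
      𝔼 →L[ℝ] ℝ) (f x)) := funext fun x => hmax _
  rw [e] at c1
  filter_upwards [c1.ae_eq hU c2] with x hx
  rw [hx, hH', hmax']
  rfl

lemma norm_deriv_comp_truncation_le (hσ : |σ| ≤ 1) {x : 𝔼}
    (h : deriv G (signedPosPart σ b (f x i)) • Dφ x =
      (σ * deriv G (signedPosPart σ b (f x i))) • derivRow Df i x) :
    ‖deriv G (signedPosPart σ b (f x i)) • Dφ x‖ ≤
      |deriv G (signedPosPart σ b (f x i))| * ‖Df x‖ := by
  rw [h, norm_smul, Real.norm_eq_abs, abs_mul]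
  gcongr
  · exact mul_le_of_le_one_left (abs_nonneg _) hσ
  · exact norm_derivRow_le Df i x

/-- The energy inequality obtained by testing the distortion inequality. -/
lemma lintegral_energy_le (hn : n ≠ 0) (hU : IsOpen U) (hvol : volume U ≠ ⊤)
    {K : 𝔼 → ℝ} {S : 𝔼 → ℝ≥0∞} (hDf : MemLp Df n (volume.restrict U))
    (hK : AEMeasurable K (volume.restrict U)) (hK1 : ∀ x ∈ U, 1 ≤ K x)
    (hS : DistortionInequality U Df K S) {q : ℝ≥0∞} (hq : 1 ≤ q)
    (hSK : MemLp (fun x => S x / ENNReal.ofReal (K x)) q (volume.restrict U))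
    (hσ : σ = 1 ∨ σ = -1) {θ : 𝔼 → ℝ} (hθm : AEMeasurable θ (volume.restrict U))
    (hθ0 : ∀ x, 0 ≤ θ x) (hθ1 : ∀ x, θ x ≤ 1) {w : 𝔼 → 𝔼 →L[ℝ] ℝ}
    (hw : ∀ᵐ x ∂(volume.restrict U), w x = (σ * θ x) • derivRow Df i x)
    (hnull : ∫ x in U, rowDet n (fun j => Function.update (derivRow Df) i w j x) = 0) :
    ∫⁻ x in U, ENNReal.ofReal (θ x) * (‖Df x‖ₑ ^ n / ENNReal.ofReal (K x)) ≤
      ∫⁻ x in U, ENNReal.ofReal (θ x) * (S x / ENNReal.ofReal (K x)) := by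
  set μ := volume.restrict U
  have : IsFiniteMeasure μ := ⟨by simpa [μ] using hvol.lt_top⟩
  have hKU : ∀ᵐ x ∂μ, 1 ≤ K x := (ae_restrict_mem hU.measurableSet).mono hK1
  set J : 𝔼 → ℝ := fun x => (Df x).det
  set T : 𝔼 → ℝ := fun x => (S x / ENNReal.ofReal (K x)).toReal
  have hSK1 := hSK.mono_exponent hq
  have hTfin : ∫⁻ x, S x / ENNReal.ofReal (K x) ∂μ ≠ ⊤ := by
    have := hSK1.2
    rw [eLpNorm_one_eq_lintegral_enorm] at this
    exact this.ne
  have hTm : AEMeasurable (fun x => S x / ENNReal.ofReal (K x)) μ := hSK1.1.aemeasurable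
  -- The defect may be infinite, but `S / K` is integrable on a set of finite measure; hence `S` is
  -- finite almost everywhere and the inequality can be read in the reals.
  have hTlt : ∀ᵐ x ∂μ, S x / ENNReal.ofReal (K x) < ⊤ := ae_lt_top' hTm hTfin
  have hTi : Integrable T μ := integrable_toReal_of_lintegral_ne_top hTm hTfin
  have hθs : AEStronglyMeasurable θ μ := hθm.aestronglyMeasurable
  have hmul : ∀ {g : 𝔼 → ℝ}, Integrable g μ → Integrable (fun x => θ x * g x) μ := fun hg =>
    hg.mono (hθs.mul hg.1) (.of_forall fun x => by
      rw [norm_mul, Real.norm_of_nonneg (hθ0 x)]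
      exact mul_le_of_le_one_left (norm_nonneg _) (hθ1 x))
  have hJi : Integrable J μ := by
    have := integrable_rowDet hn fun j => memLp_derivRow hDf j
    simpa only [rowDet_derivRow] using this
  have hEi : Integrable (fun x => ‖Df x‖ ^ n / K x) μ := by
    have h1 : Integrable (fun x => ‖Df x‖ ^ n) μ := hDf.integrable_norm_pow hn
    refine h1.mono (h1.1.div₀ hK.aestronglyMeasurable) ?_
    filter_upwards [hKU] with x hx
    rw [norm_div, Real.norm_of_nonneg (zero_le_one.trans hx)]
    exact div_le_self (norm_nonneg _) hx
  -- Row `i` of the modified determinant is `σ θ` times the original row, so the null Lagrangian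
  -- identity says that the weighted Jacobian has integral zero.
  have hJ0 : ∫ x, θ x * J x ∂μ = 0 := by
    have e : ∫ x, rowDet n (fun j => Function.update (derivRow Df) i w j x) ∂μ =
        ∫ x, σ * (θ x * J x) ∂μ := by
      refine integral_congr_ae ?_
      filter_upwards [hw] with x hx
      rw [update_apply_eq, hx, (rowDet n).map_update_smul, Function.update_eq_self,
        rowDet_derivRow, smul_eq_mul, mul_assoc]
    rw [e, integral_const_mul] at hnull
    rcases mul_eq_zero.1 hnull with h | h
    · rcases hσ with h' | h' <;> norm_num [h'] at h
    · exact h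
  have hpt : ∀ᵐ x ∂μ, θ x * (‖Df x‖ ^ n / K x) ≤ θ x * J x + θ x * T x := by
    filter_upwards [hS, hKU, hTlt] with x hx hk ht
    have hk0 : 0 < K x := zero_lt_one.trans_le hk
    rw [← mul_add]
    refine mul_le_mul_of_nonneg_left ?_ (hθ0 x)
    have hSx : S x ≠ ⊤ := by
      intro h
      rw [h, ENNReal.top_div_of_ne_top ENNReal.ofReal_ne_top] at ht
      exact lt_irrefl _ ht
    have hT : T x = (S x).toReal / K x := by
      simp only [T]
      rw [ENNReal.toReal_div, ENNReal.toReal_ofReal hk0.le]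
    have hreal : ‖Df x‖ ^ n ≤ K x * (Df x).det + (S x).toReal := by
      rw [← EReal.coe_ennreal_toReal hSx, ← EReal.coe_add, EReal.coe_le_coe_iff] at hx
      exact hx
    rw [hT, div_le_iff₀ hk0, add_mul, div_mul_cancel₀ _ hk0.ne', mul_comm]
    simp only [J]
    linarith
  have hle : ∫ x, θ x * (‖Df x‖ ^ n / K x) ∂μ ≤ ∫ x, θ x * T x ∂μ := by
    have := integral_mono_ae (hmul hEi) ((hmul hJi).add (hmul hTi)) hpt
    rw [integral_add' (hmul hJi) (hmul hTi), hJ0, zero_add] at this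
    exact this
  have e1 : ∫⁻ x, ENNReal.ofReal (θ x) * (‖Df x‖ₑ ^ n / ENNReal.ofReal (K x)) ∂μ =
      ENNReal.ofReal (∫ x, θ x * (‖Df x‖ ^ n / K x) ∂μ) := by
    rw [ofReal_integral_eq_lintegral_ofReal (hmul hEi)]
    · refine lintegral_congr_ae ?_
      filter_upwards [hKU] with x hx
      rw [ENNReal.ofReal_mul (hθ0 x), ENNReal.ofReal_div_of_pos (by linarith),
        ENNReal.ofReal_pow (norm_nonneg _), ofReal_norm]
    · filter_upwards [hKU] with x hx
      exact mul_nonneg (hθ0 x) (div_nonneg (by positivity) (by linarith))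
  have e2 : ∫⁻ x, ENNReal.ofReal (θ x) * (S x / ENNReal.ofReal (K x)) ∂μ =
      ENNReal.ofReal (∫ x, θ x * T x ∂μ) := by
    rw [ofReal_integral_eq_lintegral_ofReal (hmul hTi)
      (.of_forall fun x => mul_nonneg (hθ0 x) ENNReal.toReal_nonneg)]
    refine lintegral_congr_ae ?_
    filter_upwards [hTlt] with x hx
    rw [ENNReal.ofReal_mul (hθ0 x), ENNReal.ofReal_toReal hx.ne]
  rw [e1, e2]
  exact ENNReal.ofReal_le_ofReal hle

end Truncation

/-- The properties of the truncation `φ = (σ f_i + b)⁺` used in the supremum bound: smooth functions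
of `φ` are limits of test functions, and they can be inserted in the Jacobian. -/
def IsAdmissibleTruncation (U : Set 𝔼) (Df : 𝔼 → 𝔼 →L[ℝ] 𝔼) (i : Fin n) (φ : 𝔼 → ℝ)
    (Dφ : 𝔼 → 𝔼 →L[ℝ] ℝ) : Prop :=
  ∀ G : ℝ → ℝ, ContDiff ℝ ∞ G → (∀ t, |deriv G t| ≤ 1) → (∀ t ≤ 0, G t = 0) →
    (∀ t ≤ 0, deriv G t = 0) →
    (∃ ζ : ℕ → 𝔼 → ℝ, (∀ k, IsTestFunction U (ζ k)) ∧
      Tendsto (fun k => eLpNorm (fderiv ℝ (ζ k) - fun x => deriv G (φ x) • Dφ x) 1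
        (volume.restrict U)) atTop (𝓝 0) ∧
      ∀ᵐ x ∂(volume.restrict U), Tendsto (fun k => ζ k x) atTop (𝓝 (G (φ x)))) ∧
    ∫ x in U, rowDet n (fun j => Function.update (derivRow Df) i
      (fun x => deriv G (φ x) • Dφ x) j x) = 0

/-- The Sobolev constant in dimension `n`. -/
noncomputable def sobolevConst (n : ℕ) : ℝ≥0 :=
  eLpNormLESNormFDerivOneConst (volume : Measure (EuclideanSpace ℝ (Fin n)))
    (NNReal.conjExponent n)

/-- Chebyshev for `G ∘ φ`, Hölder on `{φ > t}` (gaining the power `1 / n`), Sobolev, and the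
weighted gradient estimate, in this order. The powers `1 / n` and `1 - (1/p + 1/q)/n` add up to more
than 1 exactly because `1/p + 1/q < 1`. The resulting bound does not involve the smoothing parameter
`ε`, which then tends to 0. -/
lemma level_decay (hn : 2 ≤ n) {p q : ℝ≥0∞} (hp : 1 ≤ p) (hq : 1 ≤ q)
    {U : Set 𝔼} {f : 𝔼 → 𝔼} {Df : 𝔼 → 𝔼 →L[ℝ] 𝔼} {K : 𝔼 → ℝ} {S : 𝔼 → ℝ≥0∞} (hU : IsOpen U)
    (hvol : volume U ≠ ⊤) (hf : HasWeakFDeriv U f Df) (hDf : MemLp Df n (volume.restrict U))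
    (hK : AEMeasurable K (volume.restrict U)) (hK1 : ∀ x ∈ U, 1 ≤ K x)
    (hS : DistortionInequality U Df K S)
    (hSK : MemLp (fun x => S x / ENNReal.ofReal (K x)) q (volume.restrict U))
    {i : Fin n} {σ b : ℝ} (hσ : σ = 1 ∨ σ = -1) {Dφ : 𝔼 → 𝔼 →L[ℝ] ℝ}
    (hφ : HasWeakFDeriv U (fun x => signedPosPart σ b (f x i)) Dφ)
    (hφm : AEStronglyMeasurable (fun x => signedPosPart σ b (f x i)) (volume.restrict U))
    (hDφm : AEStronglyMeasurable Dφ (volume.restrict U))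
    (hadm : IsAdmissibleTruncation U Df i (fun x => signedPosPart σ b (f x i)) Dφ)
    {t s : ℝ} (ht : 0 ≤ t) :
    ENNReal.ofReal (s - t) * volume.restrict U {x | s < signedPosPart σ b (f x i)} ≤
      sobolevConst n * (eLpNorm K p (volume.restrict U) *
        eLpNorm (fun x => S x / ENNReal.ofReal (K x)) q (volume.restrict U)) ^ (1 / (n : ℝ)) *
      volume.restrict U {x | t < signedPosPart σ b (f x i)} ^
        (1 + (1 - p⁻¹.toReal - q⁻¹.toReal) / n) := by
  set μ := volume.restrict U
  set φ : 𝔼 → ℝ := fun x => signedPosPart σ b (f x i)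
  have : IsFiniteMeasure μ := ⟨by simpa [μ] using hvol.lt_top⟩
  have hσ1 : |σ| ≤ 1 := by rcases hσ with h | h <;> simp [h]
  have hn2 : (2 : ℝ) ≤ n := by exact_mod_cast hn
  have hn0 : (0 : ℝ) < n := by linarith
  have hinv : ∀ s : ℝ≥0∞, 1 ≤ s → s⁻¹.toReal ≤ 1 := fun s hs => by
    rw [← ENNReal.toReal_one]
    exact ENNReal.toReal_mono ENNReal.one_ne_top (ENNReal.inv_le_one.2 hs)
  set M : ℝ≥0∞ := eLpNorm K p μ * eLpNorm (fun x => S x / ENNReal.ofReal (K x)) q μ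
  set R : ℝ≥0∞ := sobolevConst n * M ^ (1 / (n : ℝ)) * μ {x | t < φ x} ^
        (1 + (1 - p⁻¹.toReal - q⁻¹.toReal) / n)
  have key : ∀ ε : ℝ, 0 < ε → ENNReal.ofReal (s - t - ε) * μ {x | s < φ x} ≤ R := by
    intro ε hε
    obtain ⟨G, hG, hG0, hG1, hGt, hGt', hGs⟩ := exists_smooth_posPart t hε
    have hL : ∀ r, |deriv G r| ≤ 1 := fun r => by rw [abs_of_nonneg (hG0 r)]; exact hG1 r
    have hz : ∀ r ≤ 0, G r = 0 := fun r hr => hGt r (hr.trans ht)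
    have hz' : ∀ r ≤ 0, deriv G r = 0 := fun r hr => hGt' r (hr.trans ht)
    obtain ⟨⟨ζ, hζ, hζ1, hζ2⟩, hnull⟩ := hadm G hG hL hz hz'
    set w : 𝔼 → 𝔼 →L[ℝ] ℝ := fun x => deriv G (φ x) • Dφ x
    have hθm : AEStronglyMeasurable (fun x => deriv G (φ x)) μ :=
      (hG.continuous_deriv (by simp)).comp_aestronglyMeasurable hφm
    have hGm : AEStronglyMeasurable (fun x => G (φ x)) μ :=
      hG.continuous.comp_aestronglyMeasurable hφm
    have hwm : AEStronglyMeasurable w μ := hθm.smul hDφm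
    have hwae := deriv_comp_truncation_ae_eq hU hσ1 hf hφ hG hL hz hz'
    have hen := lintegral_energy_le (i := i) (by omega) hU hvol hDf hK hK1 hS hq hSK hσ
      hθm.aemeasurable (fun x => hG0 _) (fun x => hG1 _) (w := w) hwae hnull
    set A : Set 𝔼 := toMeasurable μ {x | t < φ x}
    have hAμ : μ A = μ {x | t < φ x} := measure_toMeasurable _
    have hA : ∀ x ∉ A, φ x ≤ t := fun x hx => by
      by_contra h
      exact hx (subset_toMeasurable _ _ (not_le.1 h))
    have hgrad : ∫⁻ x, ENNReal.ofReal (deriv G (φ x)) * ‖Df x‖ₑ ∂μ ≤ M ^ (1 / (n : ℝ)) *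
        μ A ^ (1 - (p⁻¹.toReal + q⁻¹.toReal) / n) :=
      lintegral_mul_le_of_energy_le hn hp hq hK
        ((ae_restrict_mem hU.measurableSet).mono hK1) hSK.1.aemeasurable hDf.1.enorm
        hθm.aemeasurable.ennreal_ofReal (fun x => by simpa using hG1 (φ x))
        (fun x hx => by rw [hGt' _ (hA x hx), ENNReal.ofReal_zero]) hen
    have hw1 : eLpNorm w 1 μ ≤ ∫⁻ x, ENNReal.ofReal (deriv G (φ x)) * ‖Df x‖ₑ ∂μ := by
      rw [eLpNorm_one_eq_lintegral_enorm]
      refine lintegral_mono_ae ?_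
      filter_upwards [hwae] with x hx
      have := norm_deriv_comp_truncation_le hσ1 hx
      rw [abs_of_nonneg (hG0 _)] at this
      rw [← ofReal_norm, ← ofReal_norm (Df x), ← ENNReal.ofReal_mul (hG0 _)]
      exact ENNReal.ofReal_le_ofReal this
    have hr : NNReal.HolderConjugate n (NNReal.conjExponent n) :=
      NNReal.HolderConjugate.conjExponent (by exact_mod_cast hn)
    set r : ℝ≥0 := NNReal.conjExponent n
    have hSob : eLpNorm (fun x => G (φ x)) r μ ≤ sobolevConst n * eLpNorm w 1 μ :=
      eLpNorm_le_of_tendsto_isTestFunction hU.measurableSet hr hζ hwm hζ1 hζ2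
    have hr1 : (1 : ℝ≥0∞) ≤ r := by exact_mod_cast hr.symm.lt.le
    have hrinv : 1 / (1 : ℝ≥0∞).toReal - 1 / (r : ℝ≥0∞).toReal = 1 / (n : ℝ) := by
      have h1 := hr.inv_add_inv_eq_one
      have h2 : ((n : ℝ≥0) : ℝ)⁻¹ + (r : ℝ)⁻¹ = 1 := by exact_mod_cast h1
      simp only [ENNReal.toReal_one, ENNReal.coe_toReal, one_div, inv_one]
      rw [NNReal.coe_natCast] at h2
      linarith
    have hL1 : ∫⁻ x, ‖G (φ x)‖ₑ ∂μ ≤ eLpNorm (fun x => G (φ x)) r μ * μ A ^ (1 / (n : ℝ)) := by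
      have e : ∫⁻ x, ‖G (φ x)‖ₑ ∂μ = ∫⁻ x in A, ‖G (φ x)‖ₑ ∂μ := by
        refine (setLIntegral_eq_of_support_subset fun x hx => ?_).symm
        by_contra hxA
        exact hx (by simp [hGt _ (hA x hxA)])
      rw [e, ← eLpNorm_one_eq_lintegral_enorm]
      refine (eLpNorm_le_eLpNorm_mul_rpow_measure_univ hr1 hGm.restrict).trans ?_
      rw [hrinv, Measure.restrict_apply_univ]
      gcongr
      exact Measure.restrict_le_self
    have hCh : ENNReal.ofReal (s - t - ε) * μ {x | s < φ x} ≤ ∫⁻ x, ‖G (φ x)‖ₑ ∂μ := by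
      refine le_trans ?_ (mul_meas_ge_le_lintegral₀ hGm.enorm (ENNReal.ofReal (s - t - ε)))
      refine mul_le_mul' le_rfl (measure_mono fun x (hx : s < φ x) => ?_)
      rw [mem_ofPred_eq, ← ofReal_norm]
      exact ENNReal.ofReal_le_ofReal
        (le_trans (by linarith [hGs (φ x)]) (Real.le_norm_self (G (φ x))))
    calc _ ≤ _ := hCh
      _ ≤ _ := hL1
      _ ≤ (sobolevConst n * (M ^ (1 / (n : ℝ)) *
          μ A ^ (1 - (p⁻¹.toReal + q⁻¹.toReal) / n))) * μ A ^ (1 / (n : ℝ)) := by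
          gcongr
          refine hSob.trans ?_
          gcongr
          exact hw1.trans hgrad
      _ = R := by
          have hx : 0 ≤ 1 - (p⁻¹.toReal + q⁻¹.toReal) / n := by
            rw [sub_nonneg, div_le_one hn0]
            linarith [hinv p hp, hinv q hq]
          simp only [R]
          rw [hAμ, mul_assoc, mul_assoc, ← ENNReal.rpow_add_of_nonneg _ _ hx (by positivity),
            mul_assoc]
          congr 3
          field_simp
          ring
  have hlim : Tendsto (fun ε : ℝ => ENNReal.ofReal (s - t - ε) * μ {x | s < φ x}) (𝓝[>] 0)
      (𝓝 (ENNReal.ofReal (s - t) * μ {x | s < φ x})) := by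
    refine ENNReal.Tendsto.mul_const ?_ (Or.inr (measure_ne_top _ _))
    have hc : Continuous fun ε : ℝ => ENNReal.ofReal (s - t - ε) :=
      ENNReal.continuous_ofReal.comp (continuous_const.sub continuous_id)
    have := (hc.tendsto 0).mono_left (nhdsWithin_le_nhds (s := Ioi (0 : ℝ)))
    simpa using this
  exact le_of_tendsto hlim (eventually_nhdsWithin_of_forall fun ε hε => key ε hε)

/-- The constant in the supremum bound. -/
noncomputable def supBoundConst (n : ℕ) (α : ℝ) : ℝ≥0 :=
  (sobolevConst n * (2 * 2 ^ (n / α))) ^ n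

/-- Stampacchia's lemma with `δ = α / n`. Taking the `n`-th power turns `M ^ (1 / n)` into `M` and
`A 0 ^ δ` into `A 0 ^ α`, and `A 0` is at most the volume of `U`. -/
lemma eLpNorm_top_pow_le (hn : 2 ≤ n) {p q : ℝ≥0∞} (hp : 1 ≤ p) (hq : 1 ≤ q)
    (hα : 0 < 1 - p⁻¹.toReal - q⁻¹.toReal)
    {U : Set 𝔼} {f : 𝔼 → 𝔼} {Df : 𝔼 → 𝔼 →L[ℝ] 𝔼} {K : 𝔼 → ℝ} {S : 𝔼 → ℝ≥0∞} (hU : IsOpen U)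
    (hvol : volume U ≠ ⊤) (hf : HasWeakFDeriv U f Df) (hDf : MemLp Df n (volume.restrict U))
    (hK : AEMeasurable K (volume.restrict U)) (hK1 : ∀ x ∈ U, 1 ≤ K x)
    (hS : DistortionInequality U Df K S)
    (hSK : MemLp (fun x => S x / ENNReal.ofReal (K x)) q (volume.restrict U))
    {i : Fin n} {σ b : ℝ} (hσ : σ = 1 ∨ σ = -1) {Dφ : 𝔼 → 𝔼 →L[ℝ] ℝ}
    (hφ : HasWeakFDeriv U (fun x => signedPosPart σ b (f x i)) Dφ)
    (hφm : AEStronglyMeasurable (fun x => signedPosPart σ b (f x i)) (volume.restrict U))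
    (hDφm : AEStronglyMeasurable Dφ (volume.restrict U))
    (hadm : IsAdmissibleTruncation U Df i (fun x => signedPosPart σ b (f x i)) Dφ) :
    eLpNorm (fun x => signedPosPart σ b (f x i)) ⊤ (volume.restrict U) ^ n ≤
      supBoundConst n (1 - p⁻¹.toReal - q⁻¹.toReal) * eLpNorm K p (volume.restrict U) *
        eLpNorm (fun x => S x / ENNReal.ofReal (K x)) q (volume.restrict U) *
        volume U ^ (1 - p⁻¹.toReal - q⁻¹.toReal) := by
  set μ := volume.restrict U
  set α : ℝ := 1 - p⁻¹.toReal - q⁻¹.toReal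
  set φ : 𝔼 → ℝ := fun x => signedPosPart σ b (f x i)
  have : IsFiniteMeasure μ := ⟨by simpa [μ] using hvol.lt_top⟩
  have hn0 : (0 : ℝ) < n := by exact_mod_cast (by omega : 0 < n)
  set M : ℝ≥0∞ := eLpNorm K p μ * eLpNorm (fun x => S x / ENNReal.ofReal (K x)) q μ with hM
  set c : ℝ≥0∞ := sobolevConst n * M ^ (1 / (n : ℝ))
  set δ : ℝ := α / n
  have hδ : 0 < δ := by positivity
  set A : ℝ → ℝ≥0∞ := fun t => μ {x | t < φ x}
  have hA : Antitone A := fun s t hst => measure_mono fun x (hx : t < φ x) => lt_of_le_of_lt hst hx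
  have hdec : ∀ t s : ℝ, 0 ≤ t → t < s → ENNReal.ofReal (s - t) * A s ≤ c * A t ^ (1 + δ) :=
    fun t s ht _ => level_decay hn hp hq hU hvol hf hDf hK hK1 hS hSK hσ hφ hφm hDφm hadm ht
  -- The value of `d` that gives equality in the smallness condition of `eq_zero_of_level_decay`.
  set B : ℝ≥0∞ := c * A 0 ^ δ * (2 * 2 ^ (1 / δ))
  have hB : eLpNorm φ ⊤ μ ≤ B := by
    -- `B` may be 0, whereas the iteration needs a positive real height; every finite `D > B`
    -- provides one.
    refine le_of_forall_gt_imp_ge_of_dense fun D hD => ?_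
    rcases eq_or_ne D ⊤ with rfl | hDt
    · exact le_top
    have hd : 0 < D.toReal := ENNReal.toReal_pos (bot_le.trans_lt hD).ne' hDt
    have hDd : ENNReal.ofReal D.toReal = D := ENNReal.ofReal_toReal hDt
    have h2 : (2 : ℝ≥0∞) * 2 ^ (1 / δ) * (2⁻¹ * 2 ^ (-(1 / δ))) = 1 := by
      rw [mul_mul_mul_comm, ENNReal.mul_inv_cancel (by norm_num) (by norm_num), one_mul,
        ← ENNReal.rpow_add _ _ (by norm_num) (by norm_num), add_neg_cancel, ENNReal.rpow_zero]
    have hz := eq_zero_of_level_decay hA (measure_ne_top _ _) hδ hdec hd (by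
      rw [hDd]
      calc c * A 0 ^ δ = B * (2⁻¹ * 2 ^ (-(1 / δ))) := by
            simp only [B]
            rw [mul_assoc (c * A 0 ^ δ), h2, mul_one]
        _ ≤ _ := by gcongr)
    have hae : ∀ᵐ x ∂μ, ‖φ x‖ ≤ D.toReal := by
      have : ∀ᵐ x ∂μ, ¬ D.toReal < φ x := by
        rw [ae_iff]
        simpa using hz
      filter_upwards [this] with x hx
      exact (Real.norm_of_nonneg (le_max_right _ _)).trans_le (not_lt.1 hx)
    rw [← hDd, eLpNorm_exponent_top]
    exact eLpNormEssSup_le_of_ae_bound hae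
  have hA0 : A 0 ≤ volume U := (measure_mono (subset_univ _)).trans (by simp [μ])
  calc eLpNorm φ ⊤ μ ^ n ≤ B ^ n := by gcongr
    _ = (sobolevConst n * (2 * 2 ^ (1 / δ))) ^ n * M * A 0 ^ α := by
        simp only [B, c]
        have e1 : (M ^ (1 / (n : ℝ))) ^ n = M := by
          rw [← ENNReal.rpow_natCast, ← ENNReal.rpow_mul, one_div_mul_cancel hn0.ne',
            ENNReal.rpow_one]
        have e2 : (A 0 ^ δ) ^ n = A 0 ^ α := by
          rw [← ENNReal.rpow_natCast, ← ENNReal.rpow_mul]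
          simp only [δ]
          rw [div_mul_cancel₀ _ hn0.ne']
        simp only [mul_pow, e1, e2]
        ring
    _ ≤ (sobolevConst n * (2 * 2 ^ (1 / δ))) ^ n * M * volume U ^ α := by gcongr
    _ = _ := by
        have : 1 / δ = n / α := by simp only [δ]; field_simp
        rw [this, supBoundConst, hM]
        push_cast
        rw [ENNReal.coe_rpow_of_nonneg _ (by positivity)]
        push_cast
        ring

/-! ### Admissibility of truncations -/

lemma HasSobolevLocDeriv.derivRow {U : Set 𝔼} {s : ℝ≥0∞} {f : 𝔼 → 𝔼} {Df : 𝔼 → 𝔼 →L[ℝ] 𝔼}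
    (h : HasSobolevLocDeriv U s f Df) (j : Fin n) :
    HasSobolevLocDeriv U s (fun x => f x j) (derivRow Df j) := by
  refine ⟨h.1.clm_comp (EuclideanSpace.proj j : 𝔼 →L[ℝ] ℝ), fun L hL hLU => ?_⟩
  obtain ⟨h1, h2⟩ := h.2 L hL hLU
  exact ⟨(EuclideanSpace.proj j : 𝔼 →L[ℝ] ℝ).comp_memLp' h1, memLp_derivRow h2 j⟩

lemma HasSobolevLocDeriv.mono {U V : Set 𝔼} {s : ℝ≥0∞} {u : 𝔼 → F} {Du : 𝔼 → 𝔼 →L[ℝ] F}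
    (h : HasSobolevLocDeriv U s u Du) (hVU : V ⊆ U) : HasSobolevLocDeriv V s u Du :=
  ⟨h.1.mono hVU, fun L hL hLV => h.2 L hL (hLV.trans hVU)⟩

lemma HasSobolevLocDeriv.memSobolevLoc_one {U : Set 𝔼} {s : ℝ≥0∞} (hs : 1 ≤ s) {u : 𝔼 → F}
    {Du : 𝔼 → 𝔼 →L[ℝ] F} (h : HasSobolevLocDeriv U s u Du) : MemSobolevLoc U 1 u := by
  refine ⟨Du, h.1, fun L hL hLU => ?_⟩
  have : IsFiniteMeasure (volume.restrict L) := ⟨by simpa using hL.measure_lt_top⟩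
  exact ⟨(h.2 L hL hLU).1.mono_exponent hs, (h.2 L hL hLU).2.mono_exponent hs⟩

/-- Truncations in `W^{1,n}_0` are admissible. -/
lemma isAdmissibleTruncation_of_memSobolevZero (hn : n ≠ 0) {U : Set 𝔼} (hU : IsOpen U)
    (hvol : volume U ≠ ⊤) {f : 𝔼 → 𝔼} {Df : 𝔼 → 𝔼 →L[ℝ] 𝔼} (hf : HasSobolevLocDeriv U n f Df)
    (hDf : MemLp Df n (volume.restrict U)) (i : Fin n) {φ : 𝔼 → ℝ} {Dφ : 𝔼 → 𝔼 →L[ℝ] ℝ}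
    (hφ : MemLp φ n (volume.restrict U)) (hDφ : MemLp Dφ n (volume.restrict U))
    (h : ∀ ε : ℝ≥0∞, 0 < ε → ∃ η : 𝔼 → ℝ, IsTestFunction U η ∧
      eLpNorm (fun x => φ x - η x) n (volume.restrict U) < ε ∧
      eLpNorm (fun x => Dφ x - fderiv ℝ η x) n (volume.restrict U) < ε) :
    IsAdmissibleTruncation U Df i φ Dφ := by
  intro G hG hL hG0 _
  have : IsFiniteMeasure (volume.restrict U) := ⟨by simpa using hvol.lt_top⟩
  have hn1 : (1 : ℝ≥0∞) ≤ n := by exact_mod_cast Nat.one_le_iff_ne_zero.2 hn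
  obtain ⟨ζ, hζ, -, h2, h3⟩ := exists_isTestFunction_tendsto_comp hn1 (by simp) hφ.1 hDφ h hG hL
    (hG0 0 le_rfl)
  have hθm : AEStronglyMeasurable (fun x => deriv G (φ x)) (volume.restrict U) :=
    (hG.continuous_deriv (by simp)).comp_aestronglyMeasurable hφ.1
  have hw : MemLp (fun x => deriv G (φ x) • Dφ x) n (volume.restrict U) := by
    refine hDφ.mono (hθm.smul hDφ.1) (.of_forall fun x => ?_)
    rw [norm_smul]
    exact mul_le_of_le_one_left (norm_nonneg _) (hL _)
  have hζL : ∀ k, MemLp (fderiv ℝ (ζ k)) n (volume.restrict U) := fun k =>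
    ((hζ k).continuous_fderiv.memLp_of_hasCompactSupport ((hζ k).2.1.fderiv ℝ)).restrict U
  refine ⟨⟨ζ, hζ, ?_, h3⟩, ?_⟩
  -- On a set of finite measure, convergence in `Lⁿ` implies convergence in `L¹`.
  · set c : ℝ≥0∞ := volume.restrict U univ ^ (1 / (1 : ℝ≥0∞).toReal - 1 / (n : ℝ≥0∞).toReal)
    have hc : c ≠ ⊤ := by
      refine ENNReal.rpow_ne_top_of_nonneg ?_ (measure_ne_top _ _)
      have : (1 : ℝ) ≤ n := by exact_mod_cast Nat.one_le_iff_ne_zero.2 hn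
      simp only [ENNReal.toReal_one, ENNReal.toReal_natCast, sub_nonneg]
      exact one_div_le_one_div_of_le one_pos this
    have hlim := ENNReal.Tendsto.mul_const h2 (Or.inr hc)
    rw [zero_mul] at hlim
    exact tendsto_of_tendsto_of_tendsto_of_le_of_le tendsto_const_nhds hlim (fun _ => bot_le)
      fun k => eLpNorm_le_eLpNorm_mul_rpow_measure_univ hn1 ((hζL k).1.sub hw.1)
  · exact integral_rowDet_update_eq_zero_of_tendsto hn (fun j _ => memLp_derivRow hDf j) hζL hw h2
      fun k => integral_rowDet_update_fderiv_eq_zero hn hU (fun j => hf.derivRow j) (hζ k) i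

/-- Extension by zero of a limit of test functions. -/
lemma hasWeakFDeriv_indicator_of_tendsto {U : Set 𝔼} (hU : MeasurableSet U) {ζ : ℕ → 𝔼 → ℝ}
    {u : 𝔼 → ℝ} {w : 𝔼 → 𝔼 →L[ℝ] ℝ} (hζ : ∀ k, IsTestFunction U (ζ k))
    (hu : IntegrableOn u U) (hw : IntegrableOn w U)
    (h1 : Tendsto (fun k => eLpNorm (ζ k - u) 1 (volume.restrict U)) atTop (𝓝 0))
    (h2 : Tendsto (fun k => eLpNorm (fderiv ℝ (ζ k) - w) 1 (volume.restrict U)) atTop (𝓝 0)) :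
    HasWeakFDeriv univ (U.indicator u) (U.indicator w) := by
  have hiu : LocallyIntegrable (U.indicator u) := (hu.integrable_indicator hU).locallyIntegrable
  have hiw : LocallyIntegrable (U.indicator w) :=
    (IntegrableOn.integrable_indicator (ε' := 𝔼 →L[ℝ] ℝ) hw hU).locallyIntegrable
  refine HasWeakFDeriv.of_tendsto (w := ζ) (Dw := fun k => fderiv ℝ (ζ k))
    (fun k => .of_contDiff (hζ k).1) (hiu.locallyIntegrableOn _) (hiw.locallyIntegrableOn _) ?_ ?_
  · refine h1.congr fun k => ?_
    have : ζ k - U.indicator u = U.indicator (ζ k - u) := by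
      ext x
      by_cases hx : x ∈ U
      · simp [hx]
      · simp [hx, (hζ k).eq_zero hx]
    rw [this, Measure.restrict_univ, eLpNorm_indicator_eq_eLpNorm_restrict hU]
  · refine h2.congr fun k => ?_
    have : fderiv ℝ (ζ k) - U.indicator w = U.indicator (fderiv ℝ (ζ k) - w) := by
      ext x : 1
      by_cases hx : x ∈ U
      · simp [hx]
      · simp [hx, (hζ k).fderiv_eq_zero_of_notMem hx]
    rw [this, Measure.restrict_univ]
    exact (eLpNorm_indicator_eq_eLpNorm_restrict (ε := 𝔼 →L[ℝ] ℝ) hU).symm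

/-- On balls compactly contained in the domain, truncations in `W^{1,1}_0` are admissible. -/
lemma isAdmissibleTruncation_ball (hn : n ≠ 0) {Ω : Set 𝔼} (hΩ : IsOpen Ω) {f : 𝔼 → 𝔼}
    {Df : 𝔼 → 𝔼 →L[ℝ] 𝔼} (hf : HasSobolevLocDeriv Ω n f Df) {x₀ : 𝔼} {r : ℝ}
    (hB : closedBall x₀ r ⊆ Ω) {i : Fin n} {σ b : ℝ} (hσ : |σ| ≤ 1) {Dφ : 𝔼 → 𝔼 →L[ℝ] ℝ}
    (hφD : HasWeakFDeriv (ball x₀ r) (fun x => signedPosPart σ b (f x i)) Dφ)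
    (hφ : MemLp (fun x => signedPosPart σ b (f x i)) 1 (volume.restrict (ball x₀ r)))
    (hDφ : MemLp Dφ 1 (volume.restrict (ball x₀ r)))
    (h : ∀ ε : ℝ≥0∞, 0 < ε → ∃ η : 𝔼 → ℝ, IsTestFunction (ball x₀ r) η ∧
      eLpNorm (fun x => signedPosPart σ b (f x i) - η x) 1 (volume.restrict (ball x₀ r)) < ε ∧
      eLpNorm (fun x => Dφ x - fderiv ℝ η x) 1 (volume.restrict (ball x₀ r)) < ε) :
    IsAdmissibleTruncation (ball x₀ r) Df i (fun x => signedPosPart σ b (f x i)) Dφ := by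
  intro G hG hL hG0 hG0'
  have hn1 : (1 : ℝ≥0∞) ≤ n := by exact_mod_cast Nat.one_le_iff_ne_zero.2 hn
  set B : Set 𝔼 := ball x₀ r
  set φ : 𝔼 → ℝ := fun x => signedPosPart σ b (f x i)
  obtain ⟨ζ, hζ, h1, h2, h3⟩ := exists_isTestFunction_tendsto_comp le_rfl ENNReal.one_ne_top hφ.1
    hDφ h hG hL (hG0 0 le_rfl)
  refine ⟨⟨ζ, hζ, h2, h3⟩, ?_⟩
  -- The functions `ζ` converge only in `W^{1,1}`, too weakly for the Jacobian. New test functions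
  -- with gradients converging in `Lⁿ` need room around the ball: `V` lies in a compact subset of
  -- `Ω`, so that `Df` is in `Lⁿ(V)`.
  obtain ⟨L, hLc, hBL, hLΩ⟩ := exists_compact_between (isCompact_closedBall x₀ r) hΩ hB
  set V : Set 𝔼 := interior L
  have hV : IsOpen V := isOpen_interior
  have hVΩ : V ⊆ Ω := interior_subset.trans hLΩ
  obtain ⟨d, hd, hdV⟩ := (isCompact_closedBall x₀ r).exists_cthickening_subset_open hV hBL
  have hfV : ∀ j, HasSobolevLocDeriv V n (fun x => f x j) (derivRow Df j) := fun j =>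
    (hf.mono hVΩ).derivRow j
  have hDfL : MemLp Df n (volume.restrict L) := (hf.2 L hLc hLΩ).2
  have hDfV : MemLp Df n (volume.restrict V) :=
    hDfL.mono_measure (Measure.restrict_mono interior_subset le_rfl)
  have hBV : B ⊆ V := ball_subset_closedBall.trans hBL
  have hDfB : MemLp Df n (volume.restrict B) :=
    hDfV.mono_measure (Measure.restrict_mono hBV le_rfl)
  set w : 𝔼 → 𝔼 →L[ℝ] ℝ := fun x => deriv G (φ x) • Dφ x
  have hBm : MeasurableSet B := measurableSet_ball
  have hθm : AEStronglyMeasurable (fun x => deriv G (φ x)) (volume.restrict B) :=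
    (hG.continuous_deriv (by simp)).comp_aestronglyMeasurable hφ.1
  have hwm : AEStronglyMeasurable w (volume.restrict B) := hθm.smul hDφ.1
  have hw1 : IntegrableOn w B := by
    refine (memLp_one_iff_integrable.1 hDφ).mono hwm (.of_forall fun x => ?_)
    rw [norm_smul]
    exact mul_le_of_le_one_left (norm_nonneg _) (hL _)
  have hu1 : IntegrableOn (fun x => G (φ x)) B := by
    refine (memLp_one_iff_integrable.1 hφ).mono (hG.continuous.comp_aestronglyMeasurable hφ.1)
      (.of_forall fun x => ?_)
    have := abs_sub_le_of_abs_deriv_le hG hL (φ x) 0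
    rwa [hG0 0 le_rfl, sub_zero, sub_zero, one_mul] at this
  -- The integrability improves from `L¹` to `Lⁿ`, because `w` equals a bounded factor times a row
  -- of `Df`.
  have hwn : MemLp w n (volume.restrict B) := by
    refine hDfB.mono hwm ?_
    filter_upwards [deriv_comp_truncation_ae_eq isOpen_ball hσ
      (hf.1.mono (ball_subset_closedBall.trans hB)) hφD hG hL hG0 hG0'] with x hx
    exact (norm_deriv_comp_truncation_le hσ hx).trans
      (mul_le_of_le_one_left (norm_nonneg _) (hL _))
  set ψ : 𝔼 → ℝ := B.indicator fun x => G (φ x)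
  set Ψ : 𝔼 → 𝔼 →L[ℝ] ℝ := B.indicator w
  have hψ : HasWeakFDeriv univ ψ Ψ := hasWeakFDeriv_indicator_of_tendsto hBm hζ hu1 hw1 h1 h2
  have hψl : LocallyIntegrable ψ := locallyIntegrableOn_univ.1 hψ.1
  have hΨ : MemLp Ψ n volume := (memLp_indicator_iff_restrict (ε := 𝔼 →L[ℝ] ℝ) hBm).2 hwn
  -- From the index `k₀` on, mollification enlarges the closed ball by less than `d`, so supports
  -- stay in `V`.
  obtain ⟨k₀, hk₀⟩ := eventually_atTop.1 ((tendsto_bumpSeq_rOut n).eventually (gt_mem_nhds hd))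
  set η : ℕ → 𝔼 → ℝ := fun k => mollify (bumpSeq n (k + k₀)) ψ
  have hη : ∀ k, IsTestFunction V (η k) := by
    intro k
    have hts : tsupport (η k) ⊆ cthickening d (closedBall x₀ r) := by
      refine closure_minimal (fun x hx => ?_) isClosed_cthickening
      by_contra hxd
      refine hx (mollify_eq_zero _ (s := closedBall x₀ r) (fun y hy => ?_) fun h => hxd
        (cthickening_mono (hk₀ _ (by omega)).le _ h))
      exact indicator_of_notMem (fun h => hy (ball_subset_closedBall h)) _
    exact ⟨contDiff_mollify _ hψl, (isCompact_closedBall x₀ r).cthickening.of_isClosed_subset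
      (isClosed_tsupport _) hts, hts.trans hdV⟩
  have hηD : ∀ k, fderiv ℝ (η k) = mollify (bumpSeq n (k + k₀)) Ψ := fun k => fderiv_mollify hψ _
  have hηL : ∀ k, MemLp (fderiv ℝ (η k)) n (volume.restrict V) := fun k =>
    ((hη k).continuous_fderiv.memLp_of_hasCompactSupport ((hη k).2.1.fderiv ℝ)).restrict V
  have hlim : Tendsto (fun k => eLpNorm (fderiv ℝ (η k) - Ψ) n (volume.restrict V)) atTop (𝓝 0) := by
    have := (tendsto_add_atTop_iff_nat k₀).2
      (tendsto_eLpNorm_mollify_bumpSeq_sub hn1 (by simp) hΨ)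
    refine tendsto_of_tendsto_of_tendsto_of_le_of_le tendsto_const_nhds this (fun _ => bot_le)
      fun k => ?_
    simp only [hηD]
    exact eLpNorm_mono_measure _ Measure.restrict_le_self
  have key := integral_rowDet_update_eq_zero_of_tendsto hn (i := i)
    (fun j _ => memLp_derivRow hDfV j) hηL (hΨ.restrict V) hlim
    fun k => integral_rowDet_update_fderiv_eq_zero hn hV hfV (hη k) i
  have e : (fun x => rowDet n fun j => Function.update (derivRow Df) i Ψ j x) =
      B.indicator fun x => rowDet n fun j => Function.update (derivRow Df) i w j x := by
    ext x
    by_cases hx : x ∈ B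
    · simp only [update_apply_eq, indicator_of_mem hx, Ψ]
    · simp only [update_apply_eq, indicator_of_notMem hx, Ψ]
      exact (rowDet n).map_update_zero _ _
  rw [e, setIntegral_indicator hBm, inter_eq_right.2 hBV] at key
  exact key

/-! ### The main estimates -/

lemma signedPosPart_one_neg (M y : ℝ) : signedPosPart 1 (-M) y = max (y - M) 0 := by
  rw [signedPosPart, one_mul, sub_eq_add_neg]

lemma signedPosPart_neg_one (m y : ℝ) : signedPosPart (-1) m y = max (m - y) 0 := by
  rw [signedPosPart]
  congr 1
  ring

lemma one_sub_inv_sub_inv_pos {p q : ℝ≥0∞} (hpq : p⁻¹ + q⁻¹ < 1) :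
    0 < 1 - p⁻¹.toReal - q⁻¹.toReal := by
  have hp : p⁻¹ ≠ ⊤ := ((le_self_add.trans_lt hpq).trans_le le_top).ne
  have hq : q⁻¹ ≠ ⊤ := ((le_add_self.trans_lt hpq).trans_le le_top).ne
  have := (ENNReal.toReal_lt_toReal (ENNReal.add_ne_top.2 ⟨hp, hq⟩) ENNReal.one_ne_top).2 hpq
  rw [ENNReal.toReal_add hp hq, ENNReal.toReal_one] at this
  linarith

lemma DistortionInequality.mono {U V : Set 𝔼} {Df : 𝔼 → 𝔼 →L[ℝ] 𝔼} {K : 𝔼 → ℝ} {S : 𝔼 → ℝ≥0∞}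
    (h : DistortionInequality U Df K S) (hVU : V ⊆ U) : DistortionInequality V Df K S :=
  ae_mono (Measure.restrict_mono hVU le_rfl) h

/-- The supremum bound for truncations in `W^{1,n}_0`. -/
lemma eLpNorm_top_pow_le_of_memSobolevZero (hn : 2 ≤ n) {p q : ℝ≥0∞} (hp : 1 ≤ p) (hq : 1 ≤ q)
    (hα : 0 < 1 - p⁻¹.toReal - q⁻¹.toReal)
    {U : Set 𝔼} {f : 𝔼 → 𝔼} {Df : 𝔼 → 𝔼 →L[ℝ] 𝔼} {K : 𝔼 → ℝ} {S : 𝔼 → ℝ≥0∞} (hU : IsOpen U)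
    (hvol : volume U ≠ ⊤) (hf : HasSobolevLocDeriv U n f Df) (hDf : MemLp Df n (volume.restrict U))
    (hK : AEMeasurable K (volume.restrict U)) (hK1 : ∀ x ∈ U, 1 ≤ K x)
    (hS : DistortionInequality U Df K S)
    (hSK : MemLp (fun x => S x / ENNReal.ofReal (K x)) q (volume.restrict U))
    {i : Fin n} {σ b : ℝ} (hσ : σ = 1 ∨ σ = -1)
    (hφ : MemSobolevZero U n (fun x => signedPosPart σ b (f x i))) :
    eLpNorm (fun x => signedPosPart σ b (f x i)) ⊤ (volume.restrict U) ^ n ≤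
      supBoundConst n (1 - p⁻¹.toReal - q⁻¹.toReal) * eLpNorm K p (volume.restrict U) *
        eLpNorm (fun x => S x / ENNReal.ofReal (K x)) q (volume.restrict U) *
        volume U ^ (1 - p⁻¹.toReal - q⁻¹.toReal) := by
  obtain ⟨Dφ, h1, h2, h3, h4⟩ := hφ
  exact eLpNorm_top_pow_le hn hp hq hα hU hvol hf.1 hDf hK hK1 hS hSK hσ h1 h2.1 h3.1
    (isAdmissibleTruncation_of_memSobolevZero (by omega) hU hvol hf hDf i h2 h3 h4)

/-- The supremum bound on balls for truncations in `W^{1,1}_0`. -/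
lemma eLpNorm_top_le_of_memSobolevZero_ball (hn : 2 ≤ n) {p q : ℝ≥0∞} (hp : 1 ≤ p) (hq : 1 ≤ q)
    (hα : 0 < 1 - p⁻¹.toReal - q⁻¹.toReal)
    {Ω : Set 𝔼} {f : 𝔼 → 𝔼} {Df : 𝔼 → 𝔼 →L[ℝ] 𝔼} {K : 𝔼 → ℝ} {S : 𝔼 → ℝ≥0∞} (hΩ : IsOpen Ω)
    (hf : HasSobolevLocDeriv Ω n f Df)
    (hK : MemLp K p (volume.restrict Ω)) (hK1 : ∀ x ∈ Ω, 1 ≤ K x)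
    (hS : DistortionInequality Ω Df K S)
    (hSK : MemLp (fun x => S x / ENNReal.ofReal (K x)) q (volume.restrict Ω)) :
    ∃ C : ℝ, 0 < C ∧ ∀ (x₀ : 𝔼) (r : ℝ), 0 < r → closedBall x₀ r ⊆ Ω → ∀ (i : Fin n) (σ b : ℝ),
      σ = 1 ∨ σ = -1 → MemSobolevZero (ball x₀ r) 1 (fun x => signedPosPart σ b (f x i)) →
      eLpNorm (fun x => signedPosPart σ b (f x i)) ⊤ (volume.restrict (ball x₀ r)) ≤
        ENNReal.ofReal (C * r ^ (1 - p⁻¹.toReal - q⁻¹.toReal)) := by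
  set α : ℝ := 1 - p⁻¹.toReal - q⁻¹.toReal
  have hn0 : (0 : ℝ) < n := by exact_mod_cast (by omega : 0 < n)
  set Q : ℝ≥0∞ := supBoundConst n α * eLpNorm K p (volume.restrict Ω) *
    eLpNorm (fun x => S x / ENNReal.ofReal (K x)) q (volume.restrict Ω) *
      volume (ball (0 : 𝔼) 1) ^ α
  have hQ : Q ≠ ⊤ := ENNReal.mul_ne_top (ENNReal.mul_ne_top (ENNReal.mul_ne_top
    ENNReal.coe_ne_top hK.2.ne) hSK.2.ne)
    (ENNReal.rpow_ne_top_of_nonneg hα.le measure_ball_lt_top.ne)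
  have hQn : Q ^ (1 / (n : ℝ)) ≠ ⊤ := ENNReal.rpow_ne_top_of_nonneg (by positivity) hQ
  -- The summand 1 only ensures positivity, since `Q` is 0 when the defect vanishes.
  refine ⟨(Q ^ (1 / (n : ℝ))).toReal + 1, by positivity, fun x₀ r hr hB i σ b hσ hφ => ?_⟩
  obtain ⟨Dφ, h1, h2, h3, h4⟩ := hφ
  set B : Set 𝔼 := ball x₀ r
  have hBΩ : B ⊆ Ω := ball_subset_closedBall.trans hB
  have hle : volume.restrict B ≤ volume.restrict Ω := Measure.restrict_mono hBΩ le_rfl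
  have hσ1 : |σ| ≤ 1 := by rcases hσ with h | h <;> simp [h]
  have hDf : MemLp Df n (volume.restrict B) :=
    (hf.2 _ (isCompact_closedBall x₀ r) hB).2.mono_measure
      (Measure.restrict_mono ball_subset_closedBall le_rfl)
  have hmain := eLpNorm_top_pow_le hn hp hq hα isOpen_ball measure_ball_lt_top.ne
    (hf.1.mono hBΩ) hDf (hK.1.aemeasurable.mono_measure hle) (fun x hx => hK1 x (hBΩ hx))
    (hS.mono hBΩ) (hSK.mono_measure hle) hσ h1 h2.1 h3.1
    (isAdmissibleTruncation_ball (by omega) hΩ hf hB hσ1 h1 h2 h3 h4)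
  set y := eLpNorm (fun x => signedPosPart σ b (f x i)) ⊤ (volume.restrict B)
  -- The volume scales like `rⁿ`, so the `n`-th root taken at the end leaves `r ^ α`.
  have hvol : volume B ^ α = (ENNReal.ofReal r ^ α) ^ n * volume (ball (0 : 𝔼) 1) ^ α := by
    rw [Measure.addHaar_ball_of_pos volume x₀ hr, ENNReal.mul_rpow_of_nonneg _ _ hα.le,
      ENNReal.ofReal_pow hr.le, finrank_euclideanSpace_fin, ← ENNReal.rpow_natCast,
      ← ENNReal.rpow_natCast, ← ENNReal.rpow_mul, ← ENNReal.rpow_mul, mul_comm (n : ℝ)]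
  have hyn : y ^ n ≤ Q * (ENNReal.ofReal r ^ α) ^ n := by
    calc y ^ n ≤ _ := hmain
      _ ≤ supBoundConst n α * eLpNorm K p (volume.restrict Ω) *
          eLpNorm (fun x => S x / ENNReal.ofReal (K x)) q (volume.restrict Ω) * volume B ^ α := by
          gcongr
      _ = _ := by
          rw [hvol]
          simp only [Q]
          ring
  have hroot : ∀ z : ℝ≥0∞, (z ^ n) ^ (1 / (n : ℝ)) = z := fun z => by
    rw [← ENNReal.rpow_natCast, ← ENNReal.rpow_mul, mul_one_div_cancel hn0.ne', ENNReal.rpow_one]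
  calc y = (y ^ n) ^ (1 / (n : ℝ)) := (hroot y).symm
    _ ≤ (Q * (ENNReal.ofReal r ^ α) ^ n) ^ (1 / (n : ℝ)) := by gcongr
    _ = Q ^ (1 / (n : ℝ)) * ENNReal.ofReal r ^ α := by
        rw [ENNReal.mul_rpow_of_nonneg _ _ (by positivity), hroot]
    _ = ENNReal.ofReal ((Q ^ (1 / (n : ℝ))).toReal * r ^ α) := by
        rw [ENNReal.ofReal_mul ENNReal.toReal_nonneg, ENNReal.ofReal_toReal hQn,
          ENNReal.ofReal_rpow_of_pos hr]
    _ ≤ _ := by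
        apply ENNReal.ofReal_le_ofReal
        gcongr
        linarith

end Sobolev

theorem proposition4 (n : ℕ) (hn : 2 ≤ n) (p q : ℝ≥0∞) (hp : 1 ≤ p) (hq : 1 ≤ q)
    (hpq : p⁻¹ + q⁻¹ < 1) :
    ∃ C : ℝ≥0, ∀ (Ω : Set (EuclideanSpace ℝ (Fin n)))
      (f : EuclideanSpace ℝ (Fin n) → EuclideanSpace ℝ (Fin n))
      (Df : EuclideanSpace ℝ (Fin n) → EuclideanSpace ℝ (Fin n) →L[ℝ] EuclideanSpace ℝ (Fin n))
      (K : EuclideanSpace ℝ (Fin n) → ℝ) (S : EuclideanSpace ℝ (Fin n) → ℝ≥0∞),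
      IsOpen Ω → Bornology.IsBounded Ω →
      HasSobolevLocDeriv Ω (n : ℝ≥0∞) f Df →
      AEMeasurable K (volume.restrict Ω) → (∀ x ∈ Ω, 1 ≤ K x) →
      AEMeasurable S (volume.restrict Ω) →
      DistortionInequality Ω Df K S →
      MemLp K p (volume.restrict Ω) →
      MemLp (fun x => S x / ENNReal.ofReal (K x)) q (volume.restrict Ω) →
      (MemLp Df (n : ℝ≥0∞) (volume.restrict Ω) →
        ∀ (i : Fin n) (φ : EuclideanSpace ℝ (Fin n) → ℝ),
          ((∃ M : ℝ, φ = fun x => max (f x i - M) 0) ∨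
            (∃ m : ℝ, φ = fun x => max (m - f x i) 0)) →
          MemSobolevZero Ω (n : ℝ≥0∞) φ →
          eLpNorm φ ∞ (volume.restrict Ω) ^ n ≤
            (C : ℝ≥0∞) * eLpNorm K p (volume.restrict Ω) *
              eLpNorm (fun x => S x / ENNReal.ofReal (K x)) q (volume.restrict Ω) *
              volume Ω ^ (1 - p⁻¹.toReal - q⁻¹.toReal)) ∧
      (∀ i : Fin n,
        IsAlmostWeaklyMonotone (1 - p⁻¹.toReal - q⁻¹.toReal) Ω (fun x => f x i)) := by
  have hα := one_sub_inv_sub_inv_pos hpq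
  refine ⟨supBoundConst n (1 - p⁻¹.toReal - q⁻¹.toReal), ?_⟩
  intro Ω f Df K S hΩ hbdd hf hK hK1 _ hdist hKp hSK
  have hvol : volume Ω ≠ ⊤ := hbdd.measure_lt_top.ne
  refine ⟨fun hDf i φ hφ hφ0 => ?_, fun i => ?_⟩
  · rcases hφ with ⟨M, rfl⟩ | ⟨m, rfl⟩
    · simp only [← signedPosPart_one_neg] at hφ0 ⊢
      exact eLpNorm_top_pow_le_of_memSobolevZero hn hp hq hα hΩ hvol hf hDf hK hK1 hdist hSK
        (Or.inl rfl) hφ0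
    · simp only [← signedPosPart_neg_one] at hφ0 ⊢
      exact eLpNorm_top_pow_le_of_memSobolevZero hn hp hq hα hΩ hvol hf hDf hK hK1 hdist hSK
        (Or.inr rfl) hφ0
  · have hn1 : (1 : ℝ≥0∞) ≤ n := by exact_mod_cast (by omega : 1 ≤ n)
    obtain ⟨C, hC, h⟩ := eLpNorm_top_le_of_memSobolevZero_ball hn hp hq hα hΩ hf hKp hK1 hdist hSK
    refine ⟨(hf.derivRow i).memSobolevLoc_one hn1, hα, C, hC, fun x₀ r hr hB M m hM hm => ⟨?_, ?_⟩⟩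
    · simp only [← signedPosPart_one_neg] at hM ⊢
      exact h x₀ r hr hB i 1 (-M) (Or.inl rfl) hM
    · simp only [← signedPosPart_neg_one] at hm ⊢
      exact h x₀ r hr hB i (-1) m (Or.inr rfl) hm
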